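/- **Fuzzy OSF term lattice.** A *fuzzy partial order* on a set $A$ is a map $R:A\times A\to[0,1]$ with $R(a,a)=1$, $R(a,c)\ge R(a,b)\wedge R(b,c)$ (where $\wedge=\min$), and $a=b$ whenever $R(a,b)>0$ and $R(b,a)>0$. A *greatest lower bound* (GLB) of $\{a,b\}$ is a $g$ with $R(g,a)>0$ and $R(g,b)>0$ such that $R(c,g)>0$ for every $c$ with $R(c,a)>0$ and $R(c,b)>0$. $R$ is a *fuzzy lattice* if it is a fuzzy partial order in which every two elements have a (necessarily unique) GLB. Let $\mathcal V$ be a countably infinite set of variables, $\mathcal F$ a set (of features), and $(\mathcal S,\preceq)$ a finite fuzzy lattice (of sorts), bounded: $\preceq(\bot,s)=1=\preceq(s,\top)$ for all $s\in\mathcal S$. *Terms.* An OSF term is $X:s(f_1\to t_1,\dots,f_n\to t_n)$ with $n\ge 0$, $X\in\mathcal V$ (its root), $s\in\mathcal S$, $f_i\in\mathcal F$, and OSF terms $t_i$. It is *normal* if $s\neq\bot$, the $f_i$ are pairwise distinct, each $t_i$ is normal, and each variable $Y$ has at most one occurrence in it as the root of a subterm different from $Y:\top$. *Semantics.* An interpretation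 $\mathcal I$ is a set $\Delta$ with maps $s^{\mathcal I}:\Delta\to[0,1]$ ($s\in\mathcal S$) and $f^{\mathcal I}:\Delta\to\Delta$ ($f\in\mathcal F$) such that $\top^{\mathcal I}=1$, $\bot^{\mathcal I}=0$, $s^{\mathcal I}(d)\wedge\preceq(s,s')\le s'^{\mathcal I}(d)$, and $g^{\mathcal I}(d)>0$ whenever $s^{\mathcal I}(d)\wedge s'^{\mathcal I}(d)>0$ and $g$ is the GLB of $s,s'$. For $t=X:s(f_i\to t_i)_{i\le n}$ and $\alpha:\mathcal V\to\Delta$ let $[\![t]\!]_\alpha(d)=\mathbf 1[d=\alpha(X)]\wedge s^{\mathcal I}(d)\wedge\bigwedge_i[\![t_i]\!]_\alpha(f_i^{\mathcal I}(d))$ and $[\![t]\!](d)=\sup_\alpha[\![t]\!]_\alpha(d)$. Put $\preceq(t_1,t_2)=\sup\{\beta\in[0,1]:\ [\![t_1]\!](d)\wedge\beta\le[\![t_2]\!](d)\text{ for all }\mathcal I\text{ and all }d\in\Delta\}$. *Equivalence.* An OSF graph is a rooted directed graph whose nodes are variables, all reachable from the root, with nodes labelled by sorts $\ne\bot$ and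 edges by features, such that no node has two outgoing edges with the same feature. The OSF graph $G(\psi)$ of a normal term $\psi$ has as nodes the variables of $\psi$, as root the root of $\psi$, as label of $Y$ the most specific $s$ such that $Y:s$ occurs in $\psi$, and an edge $Y\xrightarrow{f}Z$ whenever $f$ points in $\psi$ from a subterm with root $Y$ to one with root $Z$. The graph algebra $\mathcal G$ is the interpretation whose elements are the OSF graphs, including trivial graphs (a single node labelled $\top$ and no edge) on fresh nodes, with $s^{\mathcal G}(g)=\preceq(\text{root label of }g,s)$ and $f^{\mathcal G}(g)$ the part of $g$ reachable from the end $Y$ of the $f$-edge of the root, rooted at $Y$, if there is such an edge, and otherwise the trivial graph on a fresh node uniquely determined by $(f,g)$. Let $\mathcal G[g]$ be the subalgebra of $\mathcal G$ generated by $g$. Normal terms $\psi_0,\psi_1$ are *equivalent* if, for $(i,j)=(0,1)$ and for $(i,j)=(1,0)$, there is a map $\gamma:\mathcal G[G(\psi_i)]\to\mathcal G[G(\psi_j)]$ with $\gamma(G(\psi_i))=G(\psi_j)$, commuting with all features, and with $s^{\mathcal G}(h)\le s^{\mathcal G}(\gamma(h))$ for all $s\in\mathcal S$ and all $h$. The inconsistent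 terms $X:\bot$ ($X\in\mathcal V$) are all equivalent to one another and to no normal term. **Statement.** On the set of normal OSF terms together with the inconsistent terms $X:\bot$, the relation $\preceq$ depends only on the equivalence classes of its arguments, and the fuzzy relation that it induces on the set of equivalence classes is a fuzzy lattice: it is a fuzzy partial order, and every two classes have a GLB. -/

import Mathlib

universe u v w x

namespace FuzzyOSF

/-! ### Fuzzy orders -/

/-- A fuzzy binary relation on `A`: a membership function `A × A → [0,1]` (curried). -/
abbrev FuzzyRel (A : Type u) := A → A → unitInterval

/-- Fuzzy partial order: reflexive, max-min transitive and strongly antisymmetric. -/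
structure IsFuzzyPartialOrder {A : Type u} (R : FuzzyRel A) : Prop where
  refl : ∀ a, R a a = 1
  trans : ∀ a b c, min (R a b) (R b c) ≤ R a c
  antisymm : ∀ a b, 0 < R a b → 0 < R b a → a = b

/-- The set of (fuzzy) lower bounds of `T`. -/
def fuzzyLowerBounds {A : Type u} (R : FuzzyRel A) (T : Set A) : Set A :=
  {a | ∀ b ∈ T, 0 < R a b}

/-- `g` is a greatest lower bound of `T`. -/
def IsFuzzyGLB {A : Type u} (R : FuzzyRel A) (T : Set A) (g : A) : Prop :=
  g ∈ fuzzyLowerBounds R T ∧ ∀ a ∈ fuzzyLowerBounds R T, 0 < R a g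

/-- Fuzzy lattice: a fuzzy partial order in which every two elements have a
(unique) greatest lower bound. -/
structure IsFuzzyLattice {A : Type u} (R : FuzzyRel A) : Prop extends IsFuzzyPartialOrder R where
  exists_glb : ∀ a b, ∃! g, IsFuzzyGLB R {a, b} g

/-! ### Signatures and interpretations -/

/-- A fuzzy OSF signature with sort symbols `S` and feature symbols `F`: a finite bounded
fuzzy lattice on `S`. -/
structure FuzzySignature (S : Type u) (F : Type v) where
  finite_sorts : Finite S
  le : FuzzyRel S
  isFuzzyLattice : IsFuzzyLattice le
  bot : S
  top : S
  bot_le : ∀ s, le bot s = 1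
  le_top : ∀ s, le s top = 1

/-- A fuzzy OSF interpretation. -/
structure Interp {S : Type u} {F : Type v} (σ : FuzzySignature S F) where
  Dom : Type x
  sort : S → Dom → unitInterval
  feat : F → Dom → Dom
  sort_top : ∀ d, sort σ.top d = 1
  sort_bot : ∀ d, sort σ.bot d = 0
  sort_le : ∀ s s' d, min (sort s d) (σ.le s s') ≤ sort s' d
  sort_glb : ∀ s s' g d, IsFuzzyGLB σ.le {s, s'} g →
    0 < min (sort s d) (sort s' d) → 0 < sort g d

namespace Interp

variable {S : Type u} {F : Type v} {σ : FuzzySignature S F}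

/-- Interpretation of a word `f₁ ⋯ fₙ` of features: `fₙ ∘ ⋯ ∘ f₁`. -/
def word (A : Interp.{u, v, x} σ) (l : List F) (d : A.Dom) : A.Dom :=
  l.foldl (fun e f => A.feat f e) d

/-- The feature closure of a set of elements. -/
def featClosure (A : Interp.{u, v, x} σ) (D : Set A.Dom) : Set A.Dom :=
  {e | ∃ l : List F, ∃ d ∈ D, e = A.word l d}

/-- The subalgebra generated by the element `d`. -/
def gen (A : Interp.{u, v, x} σ) (d : A.Dom) : Interp.{u, v, x} σ where
  Dom := {e // e ∈ A.featClosure {d}}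
  sort s e := A.sort s e.1
  feat f e := ⟨A.feat f e.1, by
    obtain ⟨l, d', hd', he⟩ := e.2
    exact ⟨l ++ [f], d', hd', by simp [word, he]⟩⟩
  sort_top e := A.sort_top e.1
  sort_bot e := A.sort_bot e.1
  sort_le s s' e := A.sort_le s s' e.1
  sort_glb s s' g e := A.sort_glb s s' g e.1

/-- The generator, as an element of the generated subalgebra. -/
def genRoot (A : Interp.{u, v, x} σ) (d : A.Dom) : (A.gen d).Dom :=
  ⟨d, [], d, rfl, rfl⟩

/-- `γ` is a `β`-homomorphism from `A` to `B`. -/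
structure IsMorphism (A B : Interp.{u, v, x} σ) (β : unitInterval) (γ : A.Dom → B.Dom) : Prop where
  map_feat : ∀ f d, γ (A.feat f d) = B.feat f (γ d)
  map_sort : ∀ s d, min (A.sort s d) β ≤ B.sort s (γ d)

end Interp

/-! ### OSF terms -/

/-- OSF terms over variables `V`: `mk X s n feat sub` is `X : s(feat 0 → sub 0, …)`;
for `n = 0` this is the sorted variable `X : s`. -/
inductive OSFTerm (S : Type u) (F : Type v) (V : Type w) : Type (max u v w) where
  | mk (X : V) (s : S) (n : ℕ) (feat : Fin n → F) (sub : Fin n → OSFTerm S F V) : OSFTerm S F V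

namespace OSFTerm

variable {S : Type u} {F : Type v} {V : Type w}

/-- The sorted variable `X : s`. -/
def var (X : V) (s : S) : OSFTerm S F V := mk X s 0 Fin.elim0 Fin.elim0

/-- The root tag. -/
def root : OSFTerm S F V → V
  | mk X _ _ _ _ => X

/-- The tags occurring in a term. -/
def tags : OSFTerm S F V → Set V
  | mk X _ _ _ sub => {X} ∪ ⋃ i, (sub i).tags

/-- `t.HasSort Y s`: the sorted variable `Y : s` appears in `t`. -/
def HasSort : OSFTerm S F V → V → S → Prop
  | mk X s _ _ sub, Y, s' => (X = Y ∧ s = s') ∨ ∃ i, (sub i).HasSort Y s'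

/-- `t.Edge Y f Z`: in `t` the feature `f` points from a subterm with root `Y` to a
subterm with root `Z`. -/
def Edge : OSFTerm S F V → V → F → V → Prop
  | mk X _ _ feat sub, Y, f, Z =>
    (X = Y ∧ ∃ i, feat i = f ∧ (sub i).root = Z) ∨ ∃ i, (sub i).Edge Y f Z

open Classical in
/-- The number of occurrences of `Y` in `t` as the root variable of a subterm different
from `Y : ⊤`. -/
noncomputable def nontrivialCount (σ : FuzzySignature S F) : OSFTerm S F V → V → ℕ
  | mk X s n _ sub, Y =>
    (if X = Y ∧ ¬ (s = σ.top ∧ n = 0) then 1 else 0) + ∑ i, (sub i).nontrivialCount σ Y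

/-- Normal OSF terms (`ψ`-terms). -/
def Normal (σ : FuzzySignature S F) : OSFTerm S F V → Prop
  | mk X s n feat sub =>
    s ≠ σ.bot ∧ Function.Injective feat ∧ (∀ i, (sub i).Normal σ) ∧
      ∀ Y ∈ (mk X s n feat sub).tags, (mk X s n feat sub).nontrivialCount σ Y ≤ 1

open Classical in
/-- Denotation of a term under an assignment. -/
noncomputable def denotAt {σ : FuzzySignature S F} (A : Interp.{u, v, x} σ) (α : V → A.Dom) :
    OSFTerm S F V → A.Dom → unitInterval
  | mk X s _ feat sub, d =>
    min (min (if d = α X then 1 else 0) (A.sort s d))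
      (⨅ i, (sub i).denotAt A α (A.feat (feat i) d))

/-- Denotation of a term: the fuzzy union over all assignments. -/
noncomputable def denot {σ : FuzzySignature S F} (A : Interp.{u, v, x} σ)
    (t : OSFTerm S F V) (d : A.Dom) : unitInterval :=
  ⨆ α : V → A.Dom, t.denotAt A α d

open Classical in
/-- The most specific sort `s` such that `Y : s` appears in `t` (and `⊤` by convention where
there is none, in particular off the tags of `t`). -/
noncomputable def sortOf (σ : FuzzySignature S F) (t : OSFTerm S F V) (Y : V) : S :=
  if h : ∃ s, t.HasSort Y s ∧ ∀ s', t.HasSort Y s' → 0 < σ.le s s' then h.choose else σ.top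

end OSFTerm

/-- Semantic fuzzy subsumption of OSF terms: the supremum of the degrees `β` such that
`⟦t₁⟧(d) ∧ β ≤ ⟦t₂⟧(d)` for every interpretation and every element `d` of it. -/
noncomputable def subsumption {S : Type u} {F : Type v} {V : Type w} (σ : FuzzySignature S F)
    (t₁ t₂ : OSFTerm S F V) : unitInterval :=
  sSup {β : unitInterval | ∀ (A : Interp.{u, v, max u v w} σ) (d : A.Dom),
    min (t₁.denot A d) β ≤ t₂.denot A d}

/-! ### OSF graphs and the fuzzy OSF graph algebra -/

/-- OSF graphs. Edges are triples `(Y, f, Z)`, so that two nodes may be joined by edges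
with different features. The node labelling `λ_N : N → S ∖ {⊥}` is extended by `⊤` to the
variables that are not nodes. -/
structure OSFGraph {S : Type u} {F : Type v} (σ : FuzzySignature S F) (V : Type w) where
  nodes : Set V
  root : V
  label : V → S
  edge : V → F → V → Prop
  root_mem : root ∈ nodes
  label_ne_bot : ∀ Y ∈ nodes, label Y ≠ σ.bot
  label_off : ∀ Y, Y ∉ nodes → label Y = σ.top
  edge_mem : ∀ Y f Z, edge Y f Z → Y ∈ nodes ∧ Z ∈ nodes
  edge_functional : ∀ Y f Z Z', edge Y f Z → edge Y f Z' → Z = Z'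
  reachable : ∀ Y ∈ nodes, Relation.ReflTransGen (fun a b => ∃ f, edge a f b) root Y

section GraphAlgebra

variable {S : Type u} {F : Type v} {V : Type w} {σ : FuzzySignature S F}

theorem FuzzySignature.top_ne_bot_of_ne (σ : FuzzySignature S F) {s : S} (h : s ≠ σ.bot) :
    σ.top ≠ σ.bot := by
  intro e
  apply h
  refine σ.isFuzzyLattice.antisymm s σ.bot ?_ ?_
  · rw [← e, σ.le_top]; exact zero_lt_one
  · rw [σ.bot_le]; exact zero_lt_one

theorem OSFGraph.reach_mem (g : OSFGraph σ V) {Y Z : V} (hY : Y ∈ g.nodes)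
    (h : Relation.ReflTransGen (fun a b => ∃ f, g.edge a f b) Y Z) : Z ∈ g.nodes := by
  induction h with
  | refl => exact hY
  | tail _ h _ => obtain ⟨f, hf⟩ := h; exact (g.edge_mem _ _ _ hf).2

open Classical in
/-- The maximally connected subgraph of `g` rooted at the node `Y`. -/
noncomputable def OSFGraph.restrict (g : OSFGraph σ V) (Y : V) (hY : Y ∈ g.nodes) :
    OSFGraph σ V where
  nodes := {Z | Relation.ReflTransGen (fun a b => ∃ f, g.edge a f b) Y Z}
  root := Y
  label Z := if Relation.ReflTransGen (fun a b => ∃ f, g.edge a f b) Y Z then g.label Z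
    else σ.top
  edge Z f Z' := Relation.ReflTransGen (fun a b => ∃ f, g.edge a f b) Y Z ∧ g.edge Z f Z'
  root_mem := Relation.ReflTransGen.refl
  label_ne_bot Z hZ := by
    have hZ' : Relation.ReflTransGen (fun a b => ∃ f, g.edge a f b) Y Z := hZ
    rw [if_pos hZ']
    exact g.label_ne_bot Z (g.reach_mem hY hZ')
  label_off Z hZ := if_neg hZ
  edge_mem Z f Z' h := ⟨h.1, h.1.tail ⟨f, h.2⟩⟩
  edge_functional Z f Z' Z'' h h' := g.edge_functional Z f Z' Z'' h.2 h'.2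
  reachable Z hZ := by
    have hZ' : Relation.ReflTransGen (fun a b => ∃ f, g.edge a f b) Y Z := hZ
    induction hZ' with
    | refl => exact .refl
    | tail h1 h2 ih => obtain ⟨f, hf⟩ := h2; exact (ih h1).tail ⟨f, h1, hf⟩

/-- Elements of the fuzzy OSF graph algebra: the OSF graphs over `V`, together with the
trivial graphs `triv f g`, which have a single node, labelled `⊤`, and no edge. The node of
`triv f g` is a fresh variable, uniquely determined by `f` and `g`; it is represented by the
pair `(f, g)` itself. -/
inductive GraphElem (σ : FuzzySignature S F) (V : Type w) : Type (max u v w) where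
  | graph (g : OSFGraph σ V) : GraphElem σ V
  | triv (f : F) (g : GraphElem σ V) : GraphElem σ V

namespace GraphElem

/-- The label of the root. -/
def rootLabel : GraphElem σ V → S
  | graph g => g.label g.root
  | triv _ _ => σ.top

open Classical in
/-- Feature application: the subgraph at the end of the `f`-edge of the root if there is
one, and a fresh trivial graph otherwise. -/
noncomputable def app (f : F) : GraphElem σ V → GraphElem σ V
  | graph g =>
    if h : ∃ Y, g.edge g.root f Y then
      graph (g.restrict h.choose (g.edge_mem _ _ _ h.choose_spec).2)
    else triv f (graph g)
  | triv f' g => triv f (triv f' g)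

theorem rootLabel_ne_bot (g : GraphElem σ V) : g.rootLabel ≠ σ.bot := by
  induction g with
  | graph g => exact g.label_ne_bot _ g.root_mem
  | triv f g ih => exact σ.top_ne_bot_of_ne ih

end GraphElem

/-- The fuzzy OSF graph algebra. -/
noncomputable def graphAlgebra (σ : FuzzySignature S F) (V : Type w) :
    Interp.{u, v, max u v w} σ where
  Dom := GraphElem σ V
  sort s g := σ.le g.rootLabel s
  feat := GraphElem.app
  sort_top g := σ.le_top _
  sort_bot g := by
    by_contra h
    refine g.rootLabel_ne_bot (σ.isFuzzyLattice.antisymm _ _ (unitInterval.pos_iff_ne_zero.2 h) ?_)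
    rw [σ.bot_le]; exact zero_lt_one
  sort_le s s' g := σ.isFuzzyLattice.trans _ _ _
  sort_glb s s' m g hm h := by
    apply hm.2
    rintro b (rfl | rfl)
    · exact (lt_min_iff.1 h).1
    · exact (lt_min_iff.1 h).2

/-- The subalgebra of the graph algebra generated by the OSF graph `g`. -/
noncomputable def graphGen (g : OSFGraph σ V) : Interp.{u, v, max u v w} σ :=
  (graphAlgebra σ V).gen (GraphElem.graph g)

/-- The graph `g` as an element of the subalgebra that it generates. -/
noncomputable def graphGenRoot (g : OSFGraph σ V) : (graphGen g).Dom :=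
  (graphAlgebra σ V).genRoot (GraphElem.graph g)

/-- Equivalence of OSF graphs: there are 1-homomorphisms in both directions between the
generated subalgebras of the graph algebra that map one generator to the other. -/
def GraphEquiv (g₀ g₁ : OSFGraph σ V) : Prop :=
  (∃ γ, Interp.IsMorphism (graphGen g₀) (graphGen g₁) 1 γ ∧ γ (graphGenRoot g₀) = graphGenRoot g₁) ∧
  (∃ γ, Interp.IsMorphism (graphGen g₁) (graphGen g₀) 1 γ ∧ γ (graphGenRoot g₁) = graphGenRoot g₀)

theorem GraphEquiv.refl (g : OSFGraph σ V) : GraphEquiv g g :=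
  ⟨⟨id, ⟨fun _ _ => rfl, fun _ _ => min_le_left _ _⟩, rfl⟩,
    ⟨id, ⟨fun _ _ => rfl, fun _ _ => min_le_left _ _⟩, rfl⟩⟩

theorem GraphEquiv.symm {g₀ g₁ : OSFGraph σ V} (h : GraphEquiv g₀ g₁) : GraphEquiv g₁ g₀ :=
  ⟨h.2, h.1⟩

theorem Interp.IsMorphism.comp_one {A B C : Interp.{u, v, x} σ} {γ : A.Dom → B.Dom}
    {δ : B.Dom → C.Dom} (hδ : IsMorphism B C 1 δ) (hγ : IsMorphism A B 1 γ) :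
    IsMorphism A C 1 (δ ∘ γ) where
  map_feat f d := by simp [hγ.map_feat, hδ.map_feat]
  map_sort s d := (le_min (hγ.map_sort s d) (min_le_right _ _)).trans (hδ.map_sort s (γ d))

theorem GraphEquiv.trans {g₀ g₁ g₂ : OSFGraph σ V} (h : GraphEquiv g₀ g₁)
    (h' : GraphEquiv g₁ g₂) : GraphEquiv g₀ g₂ := by
  obtain ⟨⟨a, ha, ha'⟩, ⟨b, hb, hb'⟩⟩ := h
  obtain ⟨⟨c, hc, hc'⟩, ⟨d, hd, hd'⟩⟩ := h'
  exact ⟨⟨c ∘ a, hc.comp_one ha, by simp [ha', hc']⟩, ⟨b ∘ d, hb.comp_one hd, by simp [hb', hd']⟩⟩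

end GraphAlgebra

/-! ### The graph of a normal term -/

namespace OSFTerm

variable {S : Type u} {F : Type v} {V : Type w} {σ : FuzzySignature S F}

theorem root_mem_tags (t : OSFTerm S F V) : t.root ∈ t.tags := by
  cases t; simp [root, tags]

theorem Edge.mem_tags {t : OSFTerm S F V} {Y : V} {f : F} {Z : V} (h : t.Edge Y f Z) :
    Y ∈ t.tags ∧ Z ∈ t.tags := by
  induction t with
  | mk X s n feat sub ih =>
    simp only [Edge, tags, Set.mem_union, Set.mem_singleton_iff, Set.mem_iUnion] at h ⊢
    rcases h with ⟨rfl, i, -, rfl⟩ | ⟨i, h⟩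
    · exact ⟨.inl rfl, .inr ⟨i, root_mem_tags _⟩⟩
    · exact ⟨.inr ⟨i, (ih i h).1⟩, .inr ⟨i, (ih i h).2⟩⟩

theorem HasSort.mem_tags {t : OSFTerm S F V} {Y : V} {s : S} (h : t.HasSort Y s) :
    Y ∈ t.tags := by
  induction t with
  | mk X s n feat sub ih =>
    simp only [HasSort, tags, Set.mem_union, Set.mem_singleton_iff, Set.mem_iUnion] at h ⊢
    rcases h with ⟨rfl, -⟩ | ⟨i, h⟩
    · exact .inl rfl
    · exact .inr ⟨i, ih i h⟩

theorem HasSort.ne_bot {t : OSFTerm S F V} (ht : t.Normal σ) {Y : V} {s : S}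
    (h : t.HasSort Y s) : s ≠ σ.bot := by
  induction t with
  | mk X s n feat sub ih =>
    simp only [HasSort, Normal] at h ht
    rcases h with ⟨-, rfl⟩ | ⟨i, h⟩
    · exact ht.1
    · exact ih i (ht.2.2.1 i) h

theorem Normal.top_ne_bot {t : OSFTerm S F V} (ht : t.Normal σ) : σ.top ≠ σ.bot := by
  cases t; exact σ.top_ne_bot_of_ne ht.1

theorem sortOf_ne_bot {t : OSFTerm S F V} (ht : t.Normal σ) (Y : V) :
    t.sortOf σ Y ≠ σ.bot := by
  unfold sortOf
  split_ifs with h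
  · exact h.choose_spec.1.ne_bot ht
  · exact ht.top_ne_bot

theorem sortOf_off {t : OSFTerm S F V} {Y : V} (hY : Y ∉ t.tags) : t.sortOf σ Y = σ.top :=
  dif_neg fun ⟨_, h, _⟩ => hY h.mem_tags

theorem Edge.count_pos {t : OSFTerm S F V} {Y : V} {f : F} {Z : V} (h : t.Edge Y f Z) :
    1 ≤ t.nontrivialCount σ Y := by
  induction t with
  | mk X s n feat sub ih =>
    simp only [Edge, nontrivialCount] at h ⊢
    rcases h with ⟨rfl, i, -, -⟩ | ⟨i, h⟩
    · have : n ≠ 0 := fun h => by subst h; exact i.elim0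
      simp [this]
    · have := ih i h
      have := Finset.single_le_sum (f := fun i => (sub i).nontrivialCount σ Y)
        (fun _ _ => Nat.zero_le _) (Finset.mem_univ i)
      omega

theorem Normal.edge_functional {t : OSFTerm S F V} (ht : t.Normal σ) {Y : V} {f : F} {Z Z' : V}
    (h : t.Edge Y f Z) (h' : t.Edge Y f Z') : Z = Z' := by
  induction t with
  | mk X s n feat sub ih =>
    have hY := ht.2.2.2 Y h.mem_tags.1
    have key : ∀ {Z₁ Z₂ : V}, (X = Y ∧ ∃ i, feat i = f ∧ (sub i).root = Z₁) →
        (∃ i, (sub i).Edge Y f Z₂) → False := by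
      rintro Z₁ Z₂ ⟨rfl, i, -, -⟩ ⟨j, hj⟩
      have h1 := hj.count_pos (σ := σ)
      have h2 := Finset.single_le_sum (f := fun i => (sub i).nontrivialCount σ X)
        (fun _ _ => Nat.zero_le _) (Finset.mem_univ j)
      have : n ≠ 0 := fun h => by subst h; exact i.elim0
      simp [nontrivialCount, this] at hY
      have := hY j
      omega
    rcases h with h | h <;> rcases h' with h' | h'
    · obtain ⟨-, i, hi, rfl⟩ := h
      obtain ⟨-, j, hj, rfl⟩ := h'
      rw [ht.2.1 (hi.trans hj.symm)]
    · exact (key h h').elim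
    · exact (key h' h).elim
    · obtain ⟨i, hi⟩ := h
      obtain ⟨j, hj⟩ := h'
      by_cases hij : i = j
      · subst hij
        exact ih i (ht.2.2.1 i) hi hj
      · exfalso
        have h1 := hi.count_pos (σ := σ)
        have h2 := hj.count_pos (σ := σ)
        have h3 := Finset.add_le_sum (f := fun i => (sub i).nontrivialCount σ Y)
          (s := Finset.univ) (fun _ _ => Nat.zero_le _) (Finset.mem_univ i) (Finset.mem_univ j) hij
        simp only [nontrivialCount] at hY h3
        omega

theorem reachable_of_mem_tags {t : OSFTerm S F V} {Y : V} (hY : Y ∈ t.tags) :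
    Relation.ReflTransGen (fun a b => ∃ f, t.Edge a f b) t.root Y := by
  induction t with
  | mk X s n feat sub ih =>
    simp only [tags, Set.mem_union, Set.mem_singleton_iff, Set.mem_iUnion] at hY
    rcases hY with rfl | ⟨i, hi⟩
    · exact .refl
    · refine .head ⟨feat i, .inl ⟨rfl, i, rfl, rfl⟩⟩ 
        (Relation.ReflTransGen.mono (fun a b h => ?_) _ _ (ih i hi))
      obtain ⟨f, hf⟩ := h
      exact ⟨f, .inr ⟨i, hf⟩⟩

/-- The OSF graph `G(ψ)` of a normal term `ψ`: its nodes are the tags of `ψ`. -/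
noncomputable def toGraph (t : OSFTerm S F V) (ht : t.Normal σ) : OSFGraph σ V where
  nodes := t.tags
  root := t.root
  label := t.sortOf σ
  edge := t.Edge
  root_mem := t.root_mem_tags
  label_ne_bot Y _ := sortOf_ne_bot ht Y
  label_off _ hY := sortOf_off hY
  edge_mem _ _ _ h := h.mem_tags
  edge_functional _ _ _ _ h h' := ht.edge_functional h h'
  reachable _ hY := reachable_of_mem_tags hY

end OSFTerm

/-! ### Term equivalence -/

section Equivalence

variable {S : Type u} {F : Type v}

/-- The normal OSF terms, together with the inconsistent terms `X : ⊥`. -/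
def PsiTerm (σ : FuzzySignature S F) (V : Type w) : Type (max u v w) :=
  {t : OSFTerm S F V // t.Normal σ ∨ ∃ X, t = OSFTerm.var X σ.bot}

/-- Equivalence of terms: two normal terms are equivalent if their graphs are, all
inconsistent terms `X : ⊥` are equivalent, and no normal term is equivalent to one of them. -/
def TermEquiv {V : Type w} (σ : FuzzySignature S F) (t₀ t₁ : PsiTerm σ V) : Prop :=
  (∃ (h₀ : t₀.1.Normal σ) (h₁ : t₁.1.Normal σ), GraphEquiv (t₀.1.toGraph h₀) (t₁.1.toGraph h₁)) ∨
    ((∃ X, t₀.1 = OSFTerm.var X σ.bot) ∧ ∃ X, t₁.1 = OSFTerm.var X σ.bot)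

theorem not_normal_var_bot {V : Type w} {σ : FuzzySignature S F} (X : V) :
    ¬ (OSFTerm.var X σ.bot : OSFTerm S F V).Normal σ := fun h => h.1 rfl

/-- Terms modulo equivalence. -/
def termSetoid (σ : FuzzySignature S F) (V : Type w) : Setoid (PsiTerm σ V) where
  r := TermEquiv σ
  iseqv :=
    { refl := by
        rintro ⟨t, ht | ht⟩
        · exact .inl ⟨ht, ht, GraphEquiv.refl _⟩
        · exact .inr ⟨ht, ht⟩
      symm := by
        rintro t₀ t₁ (⟨h₀, h₁, h⟩ | ⟨h₀, h₁⟩)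
        · exact .inl ⟨h₁, h₀, h.symm⟩
        · exact .inr ⟨h₁, h₀⟩
      trans := by
        rintro t₀ t₁ t₂ (⟨h₀, h₁, h⟩ | ⟨h₀, h₁⟩) (⟨h₁', h₂, h'⟩ | ⟨h₁', h₂⟩)
        · exact .inl ⟨h₀, h₂, h.trans h'⟩
        · obtain ⟨X, hX⟩ := h₁'
          exact (not_normal_var_bot X (hX ▸ h₁)).elim
        · obtain ⟨X, hX⟩ := h₁
          exact (not_normal_var_bot X (hX ▸ h₁')).elim
        · exact .inr ⟨h₀, h₂⟩ }

end Equivalence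

end FuzzyOSF

universe y

namespace FuzzyOSF

/-! ### Words and denotations -/

section Denotation

variable {S : Type u} {F : Type v} {V : Type w} {σ : FuzzySignature S F}

/-! The graph of a normal term `t` is a generic model of `t`. It satisfies `t` to degree 1 in the
graph algebra (`denotAt_toGraph`). Conversely, an assignment satisfying `t` at `d` to a degree at
least `p > 0` extends to a `p`-homomorphism, defined on the parts of the graph of `t`, that sends
the graph to `d` (`isMorphismOn_extend`). Homomorphisms carry denotations along, so the degree of
`t'` at the graph of `t`, under any assignment, bounds the subsumption of `t` by `t'` from below. In
particular, subsumption is positive exactly when `t'` has positive degree at the graph of `t`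
(`subsumption_pos_iff`).

A 1-homomorphism between generated subalgebras therefore gives subsumption of degree 1 in the
opposite direction, and transitivity makes subsumption invariant under equivalence. For
antisymmetry, positive subsumption both ways gives homomorphisms of positive degree both ways. They
send the element reached by a word of features to the element reached by the same word, so the two
root labels at each word lie below each other to positive degree and are equal. Hence the
homomorphisms have degree 1 on the generated subalgebras.

Being a GLB concerns only positivity. If no normal term lies below both `t₁` and `t₂`, an
inconsistent term is the GLB. Otherwise the meet is read off from the class of all common pointed
models: identify two words of features when they lead to the same element in every such model, and
label a word by the least sort that is positive there in every such model. This sort exists because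
sorts are finite in number and these sets of sorts are closed under GLBs. Restricted to the classes
of the finitely many paths of `t₁` and `t₂`, this is a finite graph. Unfolding it along a spanning
tree gives a normal term whose models, in the sense of positive degree, are exactly the common
models (`exists_normal_meet`). -/

theorem FuzzySignature.eq_of_le_pos (σ : FuzzySignature S F) {s s' : S} (h : 0 < σ.le s s')
    (h' : 0 < σ.le s' s) : s = s' :=
  σ.isFuzzyLattice.antisymm s s' h h'

theorem FuzzySignature.le_self (σ : FuzzySignature S F) (s : S) : σ.le s s = 1 :=
  σ.isFuzzyLattice.refl s

theorem FuzzySignature.eq_top_of_le_pos (σ : FuzzySignature S F) {s : S}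
    (h : 0 < σ.le σ.top s) : s = σ.top :=
  (σ.eq_of_le_pos h (by rw [σ.le_top]; exact zero_lt_one)).symm

namespace Interp

theorem word_cons (A : Interp.{u, v, x} σ) (f : F) (l : List F) (d : A.Dom) :
    A.word (f :: l) d = A.word l (A.feat f d) := rfl

theorem word_concat (A : Interp.{u, v, x} σ) (f : F) (l : List F) (d : A.Dom) :
    A.word (l ++ [f]) d = A.feat f (A.word l d) := by
  simp [word]

theorem mem_featClosure_singleton {A : Interp.{u, v, x} σ} {d e : A.Dom} :
    e ∈ A.featClosure {d} ↔ ∃ l, e = A.word l d := by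
  simp [featClosure]

theorem feat_mem_featClosure {A : Interp.{u, v, x} σ} {d e : A.Dom}
    (h : e ∈ A.featClosure {d}) (f : F) : A.feat f e ∈ A.featClosure {d} :=
  ((A.gen d).feat f ⟨e, h⟩).2

/-- `γ` restricts to a `β`-homomorphism into `B` on the feature-closed set `D`. -/
structure IsMorphismOn {A : Interp.{u, v, x} σ} {B : Interp.{u, v, y} σ} (D : Set A.Dom)
    (β : unitInterval) (γ : A.Dom → B.Dom) : Prop where
  feat_mem : ∀ f, ∀ d ∈ D, A.feat f d ∈ D
  map_feat : ∀ f, ∀ d ∈ D, γ (A.feat f d) = B.feat f (γ d)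
  map_sort : ∀ s, ∀ d ∈ D, min (A.sort s d) β ≤ B.sort s (γ d)

theorem IsMorphismOn.map_word {A : Interp.{u, v, x} σ} {B : Interp.{u, v, y} σ} {D : Set A.Dom}
    {β : unitInterval} {γ : A.Dom → B.Dom} (h : IsMorphismOn D β γ) (l : List F) {d : A.Dom}
    (hd : d ∈ D) : A.word l d ∈ D ∧ γ (A.word l d) = B.word l (γ d) := by
  induction l generalizing d with
  | nil => exact ⟨hd, rfl⟩
  | cons f l ih =>
    rw [word_cons, word_cons, ← h.map_feat f d hd]
    exact ih (h.feat_mem f d hd)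

end Interp

namespace OSFTerm

/-- Threshold form of the recursion, which turns minima and infima into conjunctions. Positivity of
`p` is what makes the indicator force `d = α X`. -/
theorem denotAt_mk {A : Interp.{u, v, x} σ} (α : V → A.Dom) (X : V) (s : S) (n : ℕ)
    (feat : Fin n → F) (sub : Fin n → OSFTerm S F V) (d : A.Dom) (p : unitInterval)
    (hp : 0 < p) :
    p ≤ (mk X s n feat sub).denotAt A α d ↔ d = α X ∧ p ≤ A.sort s d ∧
      ∀ i, p ≤ (sub i).denotAt A α (A.feat (feat i) d) := by
  rw [denotAt, le_min_iff, le_min_iff, le_iInf_iff, and_assoc]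
  refine and_congr_left fun _ => ?_
  by_cases h : d = α X
  · simp [h, unitInterval.le_one']
  · simp [h, hp.ne']

theorem denotAt_eq_root {A : Interp.{u, v, x} σ} {α : V → A.Dom} {t : OSFTerm S F V} {d : A.Dom}
    (h : 0 < t.denotAt A α d) : d = α t.root := by
  cases t
  exact ((denotAt_mk _ _ _ _ _ _ _ _ h).1 le_rfl).1

/-- Only elements reached from `d` by features matter, so a homomorphism on a feature-closed set
containing `d` suffices; the values of `α` may lie outside it. -/
theorem _root_.FuzzyOSF.Interp.IsMorphismOn.denotAt_le {A : Interp.{u, v, x} σ}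
    {B : Interp.{u, v, y} σ} {D : Set A.Dom} {β : unitInterval} {γ : A.Dom → B.Dom}
    (h : Interp.IsMorphismOn D β γ) (α : V → A.Dom) (t : OSFTerm S F V) {d : A.Dom} (hd : d ∈ D) :
    min (t.denotAt A α d) β ≤ t.denotAt B (γ ∘ α) (γ d) := by
  induction t generalizing d with
  | mk X s n feat sub ih =>
    rcases eq_or_ne (min ((mk X s n feat sub).denotAt A α d) β) 0 with h0 | h0
    · rw [h0]; exact unitInterval.nonneg'
    · have h0 := unitInterval.pos_iff_ne_zero.2 h0
      obtain ⟨h1, h2, h3⟩ := (denotAt_mk _ _ _ _ _ _ _ _ h0).1 (min_le_left _ _)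
      refine (denotAt_mk _ _ _ _ _ _ _ _ h0).2 ⟨congrArg γ h1, ?_, fun i => ?_⟩
      · exact (le_min h2 (min_le_right _ _)).trans (h.map_sort s d hd)
      · rw [← h.map_feat _ _ hd]
        exact (le_min (h3 i) (min_le_right _ _)).trans (ih i (h.feat_mem _ _ hd))

theorem denotAt_le_sort {A : Interp.{u, v, x} σ} {α : V → A.Dom} {t : OSFTerm S F V} {d : A.Dom}
    {p : unitInterval} (hp : 0 < p) (h : p ≤ t.denotAt A α d) {Y : V} {s : S}
    (hY : t.HasSort Y s) : p ≤ A.sort s (α Y) := by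
  induction t generalizing d with
  | mk X s n feat sub ih =>
    obtain ⟨h1, h2, h3⟩ := (denotAt_mk _ _ _ _ _ _ _ _ hp).1 h
    rcases hY with ⟨rfl, rfl⟩ | ⟨i, hi⟩
    · rwa [← h1]
    · exact ih i (h3 i) hi

theorem denotAt_edge {A : Interp.{u, v, x} σ} {α : V → A.Dom} {t : OSFTerm S F V} {d : A.Dom}
    {p : unitInterval} (hp : 0 < p) (h : p ≤ t.denotAt A α d) {Y : V} {f : F} {Z : V}
    (hY : t.Edge Y f Z) : α Z = A.feat f (α Y) := by
  induction t generalizing d with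
  | mk X s n feat sub ih =>
    obtain ⟨h1, h2, h3⟩ := (denotAt_mk _ _ _ _ _ _ _ _ hp).1 h
    rcases hY with ⟨rfl, i, rfl, rfl⟩ | ⟨i, hi⟩
    · rw [← h1]; exact (denotAt_eq_root (hp.trans_le (h3 i))).symm
    · exact ih i (h3 i) hi

theorem denotAt_le_denot {A : Interp.{u, v, x} σ} (α : V → A.Dom) (t : OSFTerm S F V) (d : A.Dom) :
    t.denotAt A α d ≤ t.denot A d :=
  le_iSup (fun α => t.denotAt A α d) α

theorem denot_pos_iff {A : Interp.{u, v, x} σ} {t : OSFTerm S F V} {d : A.Dom} :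
    0 < t.denot A d ↔ ∃ α, 0 < t.denotAt A α d :=
  lt_iSup_iff

theorem denot_var_bot (A : Interp.{u, v, x} σ) (X : V) (d : A.Dom) :
    (var X σ.bot : OSFTerm S F V).denot A d = 0 := by
  by_contra h
  obtain ⟨α, h⟩ := denot_pos_iff.1 (unitInterval.pos_iff_ne_zero.2 h)
  have := ((denotAt_mk _ _ _ _ _ _ _ _ h).1 le_rfl).2.1
  rw [A.sort_bot] at this
  exact absurd h this.not_gt

end OSFTerm

end Denotation

/-! ### Graphs of normal terms inside the graph algebra -/

section TermGraph

variable {S : Type u} {F : Type v} {V : Type w} {σ : FuzzySignature S F}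

/-- Every node is reachable from the root, so nothing is cut off. Equality of the labels also uses
that they are `⊤` off the nodes. -/
theorem OSFGraph.restrict_root (g : OSFGraph σ V) : g.restrict g.root g.root_mem = g := by
  have hn : ∀ Y, Relation.ReflTransGen (fun a b => ∃ f, g.edge a f b) g.root Y ↔ Y ∈ g.nodes :=
    fun Y => ⟨g.reach_mem g.root_mem, g.reachable Y⟩
  have h1 : (g.restrict g.root g.root_mem).nodes = g.nodes := Set.ext hn
  have h2 : (g.restrict g.root g.root_mem).label = g.label := by
    funext Y
    by_cases h : Y ∈ g.nodes
    · exact if_pos ((hn Y).2 h)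
    · exact (if_neg fun h' => h ((hn Y).1 h')).trans (g.label_off Y h).symm
  have h3 : (g.restrict g.root g.root_mem).edge = g.edge := by
    funext Y f Z
    simp only [restrict, hn, eq_iff_iff, and_iff_right_iff_imp]
    exact fun h => (g.edge_mem _ _ _ h).1
  have h4 : (g.restrict g.root g.root_mem).root = g.root := rfl
  generalize g.restrict g.root g.root_mem = g' at *
  cases g; cases g'
  simp_all

theorem OSFGraph.restrict_reach_iff (g : OSFGraph σ V) {Y : V} (hY : Y ∈ g.nodes) {Z Z' : V}
    (hZ : Relation.ReflTransGen (fun a b => ∃ f, g.edge a f b) Y Z) :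
    Relation.ReflTransGen (fun a b => ∃ f, (g.restrict Y hY).edge a f b) Z Z' ↔
      Relation.ReflTransGen (fun a b => ∃ f, g.edge a f b) Z Z' := by
  constructor
  · exact Relation.ReflTransGen.mono (fun a b ⟨f, hf⟩ => ⟨f, hf.2⟩) _ _
  · intro h
    induction h with
    | refl => exact .refl
    | tail h1 h2 ih =>
      obtain ⟨f, hf⟩ := h2
      exact ih.tail ⟨f, hZ.trans h1, hf⟩

theorem OSFGraph.restrict_restrict (g : OSFGraph σ V) {Y Z : V} (hY : Y ∈ g.nodes)
    (hZ : Z ∈ (g.restrict Y hY).nodes) (hZ' : Z ∈ g.nodes) :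
    (g.restrict Y hY).restrict Z hZ = g.restrict Z hZ' := by
  have hr : Relation.ReflTransGen (fun a b => ∃ f, g.edge a f b) Y Z := hZ
  have h1 : ((g.restrict Y hY).restrict Z hZ).nodes = (g.restrict Z hZ').nodes :=
    Set.ext fun W => g.restrict_reach_iff hY hr
  have h2 : ((g.restrict Y hY).restrict Z hZ).label = (g.restrict Z hZ').label := by
    funext W
    by_cases h : Relation.ReflTransGen (fun a b => ∃ f, g.edge a f b) Z W
    · exact (if_pos ((g.restrict_reach_iff hY hr).2 h)).trans
        ((if_pos (hr.trans h)).trans (if_pos h).symm)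
    · exact (if_neg fun h' => h ((g.restrict_reach_iff hY hr).1 h')).trans (if_neg h).symm
  have h3 : ((g.restrict Y hY).restrict Z hZ).edge = (g.restrict Z hZ').edge := by
    funext W f W'
    refine propext ⟨fun h => ⟨(g.restrict_reach_iff hY hr).1 h.1, h.2.2⟩,
      fun h => ⟨(g.restrict_reach_iff hY hr).2 h.1, hr.trans h.1, h.2⟩⟩
  have h4 : ((g.restrict Y hY).restrict Z hZ).root = (g.restrict Z hZ').root := rfl
  generalize (g.restrict Y hY).restrict Z hZ = g' at *
  generalize g.restrict Z hZ' = g'' at *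
  cases g''; cases g'
  simp_all

theorem GraphElem.app_graph (g : OSFGraph σ V) {f : F} {Z : V} (h : g.edge g.root f Z) :
    app f (graph g) = graph (g.restrict Z (g.edge_mem _ _ _ h).2) := by
  have hex : ∃ Y, g.edge g.root f Y := ⟨Z, h⟩
  have hc : hex.choose = Z := g.edge_functional _ _ _ _ hex.choose_spec h
  rw [app, dif_pos hex]
  congr 2

theorem GraphElem.app_restrict (g : OSFGraph σ V) {Y : V} {f : F} {Z : V} (h : g.edge Y f Z) :
    app f (graph (g.restrict Y (g.edge_mem _ _ _ h).1)) =
      graph (g.restrict Z (g.edge_mem _ _ _ h).2) := by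
  have h' : (g.restrict Y (g.edge_mem _ _ _ h).1).edge
      (g.restrict Y (g.edge_mem _ _ _ h).1).root f Z := ⟨.refl, h⟩
  rw [app_graph _ h', OSFGraph.restrict_restrict]

namespace OSFTerm

/-- In a normal term a tag has at most one sort other than `⊤`. -/
theorem Normal.hasSort_eq_or {t : OSFTerm S F V} (ht : t.Normal σ) {Y : V} {s s' : S}
    (h : t.HasSort Y s) (h' : t.HasSort Y s') : s = s' ∨ s = σ.top ∨ s' = σ.top := by
  have pos : ∀ {t : OSFTerm S F V} {s : S}, t.HasSort Y s → s ≠ σ.top →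
      1 ≤ t.nontrivialCount σ Y := by
    intro t s h hs
    induction t with
    | mk X s₀ n feat sub ih =>
      rcases h with ⟨rfl, rfl⟩ | ⟨i, hi⟩
      · simp [nontrivialCount, hs]
      · have := Finset.single_le_sum (f := fun i => (sub i).nontrivialCount σ Y)
          (fun _ _ => Nat.zero_le _) (Finset.mem_univ i)
        have := ih i hi
        simp only [nontrivialCount]
        omega
  by_contra! hne
  obtain ⟨hne, hs, hs'⟩ := hne
  induction t with
  | mk X s₀ n feat sub ih =>
    have hc := ht.2.2.2 Y h.mem_tags
    simp only [nontrivialCount] at hc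
    have key : ∀ {s₁ s₂ : S}, s₁ ≠ σ.top → s₂ ≠ σ.top → (X = Y ∧ s₀ = s₁) →
        (∃ i, (sub i).HasSort Y s₂) → False := by
      rintro s₁ s₂ h1 h2 ⟨rfl, rfl⟩ ⟨i, hi⟩
      have h3 := Finset.single_le_sum (f := fun i => (sub i).nontrivialCount σ X)
        (fun _ _ => Nat.zero_le _) (Finset.mem_univ i)
      have h4 := pos hi h2
      rw [if_pos ⟨rfl, fun h => h1 h.1⟩] at hc
      omega
    rcases h with h | h <;> rcases h' with h' | h'
    · exact hne (h.2.symm.trans h'.2)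
    · exact key hs hs' h h'
    · exact key hs' hs h' h
    · obtain ⟨i, hi⟩ := h
      obtain ⟨j, hj⟩ := h'
      by_cases hij : i = j
      · subst hij
        exact ih i (ht.2.2.1 i) hi hj
      · have h1 := pos hi hs
        have h2 := pos hj hs'
        have h3 := Finset.add_le_sum (f := fun i => (sub i).nontrivialCount σ Y)
          (s := Finset.univ) (fun _ _ => Nat.zero_le _) (Finset.mem_univ i) (Finset.mem_univ j) hij
        omega

/-- A tag carries at most one sort besides `⊤`, so a most specific sort exists and the comparison
has degree 1, not merely positive degree. This is why a graph satisfies its term to degree 1. -/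
theorem Normal.le_sortOf {t : OSFTerm S F V} (ht : t.Normal σ) {Y : V} {s : S}
    (h : t.HasSort Y s) : σ.le (t.sortOf σ Y) s = 1 := by
  have hex : ∃ s, t.HasSort Y s ∧ ∀ s', t.HasSort Y s' → 0 < σ.le s s' := by
    by_cases hs : ∃ s, t.HasSort Y s ∧ s ≠ σ.top
    · obtain ⟨s, hs, hs'⟩ := hs
      refine ⟨s, hs, fun s' h' => ?_⟩
      rcases ht.hasSort_eq_or hs h' with rfl | h | rfl
      · rw [σ.le_self]; exact zero_lt_one
      · exact absurd h hs'
      · rw [σ.le_top]; exact zero_lt_one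
    · push Not at hs
      refine ⟨s, h, fun s' h' => ?_⟩
      rw [hs s' h', σ.le_top]
      exact zero_lt_one
  rw [sortOf, dif_pos hex]
  rcases ht.hasSort_eq_or hex.choose_spec.1 h with h1 | h1 | h1
  · rw [h1, σ.le_self]
  · have := hex.choose_spec.2 s h
    rw [h1] at this ⊢
    rw [σ.eq_top_of_le_pos this, σ.le_top]
  · rw [h1, σ.le_top]

theorem sortOf_hasSort_or_top (t : OSFTerm S F V) (Y : V) :
    t.HasSort Y (t.sortOf σ Y) ∨ t.sortOf σ Y = σ.top := by
  unfold sortOf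
  split_ifs with h
  · exact .inl h.choose_spec.1
  · exact .inr rfl

/-- The assignment that sends a node of `g` to the subgraph of `g` rooted at it. -/
noncomputable def _root_.FuzzyOSF.OSFGraph.assign (g : OSFGraph σ V) (Y : V) : GraphElem σ V :=
  open Classical in if h : Y ∈ g.nodes then .graph (g.restrict Y h) else .graph g

theorem _root_.FuzzyOSF.OSFGraph.assign_mem (g : OSFGraph σ V) {Y : V} (h : Y ∈ g.nodes) :
    g.assign Y = .graph (g.restrict Y h) := dif_pos h

theorem _root_.FuzzyOSF.OSFGraph.assign_root (g : OSFGraph σ V) :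
    g.assign g.root = .graph g := by
  rw [g.assign_mem g.root_mem, g.restrict_root]

theorem _root_.FuzzyOSF.OSFGraph.rootLabel_assign (g : OSFGraph σ V) {Y : V} (h : Y ∈ g.nodes) :
    (g.assign Y).rootLabel = g.label Y := by
  rw [g.assign_mem h]
  exact if_pos .refl

theorem _root_.FuzzyOSF.OSFGraph.app_assign (g : OSFGraph σ V) {Y : V} {f : F} {Z : V}
    (h : g.edge Y f Z) : GraphElem.app f (g.assign Y) = g.assign Z := by
  rw [g.assign_mem (g.edge_mem _ _ _ h).1, g.assign_mem (g.edge_mem _ _ _ h).2,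
    GraphElem.app_restrict _ h]

theorem denotAt_assign (t : OSFTerm S F V) (g : OSFGraph σ V)
    (he : ∀ Y f Z, t.Edge Y f Z → g.edge Y f Z) (hn : t.tags ⊆ g.nodes)
    (hs : ∀ Y s, t.HasSort Y s → σ.le (g.label Y) s = 1) :
    t.denotAt (graphAlgebra σ V) g.assign (g.assign t.root) = 1 := by
  refine le_antisymm unitInterval.le_one' ?_
  induction t with
  | mk X s n feat sub ih =>
    refine (denotAt_mk _ _ _ _ _ _ _ _ zero_lt_one).2 ⟨rfl, ?_, fun i => ?_⟩
    · have hX : X ∈ g.nodes := hn (root_mem_tags (mk X s n feat sub))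
      change 1 ≤ σ.le (g.assign X).rootLabel s
      rw [g.rootLabel_assign hX, hs X s (.inl ⟨rfl, rfl⟩)]
    · have : (graphAlgebra σ V).feat (feat i) (g.assign X) = g.assign (sub i).root :=
        g.app_assign (he _ _ _ (.inl ⟨rfl, i, rfl, rfl⟩))
      change 1 ≤ (sub i).denotAt _ _ ((graphAlgebra σ V).feat (feat i) (g.assign X))
      rw [this]
      refine ih i (fun Y f Z h => he _ _ _ (.inr ⟨i, h⟩)) (fun Y h => hn ?_)
        fun Y s h => hs _ _ (.inr ⟨i, h⟩)
      exact .inr (Set.mem_iUnion.2 ⟨i, h⟩)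

/-- A normal term denotes its own graph to degree one in the graph algebra. -/
theorem denotAt_toGraph {t : OSFTerm S F V} (ht : t.Normal σ) :
    t.denotAt (graphAlgebra σ V) (t.toGraph ht).assign (.graph (t.toGraph ht)) = 1 := by
  have := t.denotAt_assign (t.toGraph ht) (fun _ _ _ h => h) (fun _ h => h)
    fun Y s h => ht.le_sortOf h
  rwa [show t.root = (t.toGraph ht).root from rfl, OSFGraph.assign_root] at this

/-- The elements of the graph algebra whose underlying graph is a part of the graph of `t`. -/
def PartOf (σ : FuzzySignature S F) (t : OSFTerm S F V) : GraphElem σ V → Prop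
  | .graph g => (∀ Y f Z, g.edge Y f Z → t.Edge Y f Z) ∧ ∀ Y, g.label Y = t.sortOf σ Y ∨ Y ∉ g.nodes
  | .triv _ h => PartOf σ t h

/-- The extension to the graph algebra of an assignment. -/
def extend (A : Interp.{u, v, x} σ) (α : V → A.Dom) : GraphElem σ V → A.Dom
  | .graph g => α g.root
  | .triv f h => A.feat f (extend A α h)

theorem PartOf.toGraph {t : OSFTerm S F V} (ht : t.Normal σ) :
    (GraphElem.graph (t.toGraph ht) : (graphAlgebra σ V).Dom) ∈ {h | PartOf σ t h} :=
  ⟨fun _ _ _ h => h, fun _ => .inl rfl⟩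

/-- A term that denotes something yields a homomorphism out of its graph. -/
theorem isMorphismOn_extend {A : Interp.{u, v, x} σ} {α : V → A.Dom} {t : OSFTerm S F V}
    {d : A.Dom} {p : unitInterval} (hp : 0 < p) (h : p ≤ t.denotAt A α d) :
    Interp.IsMorphismOn (A := graphAlgebra σ V) {h | PartOf σ t h} p (extend A α) := by
  refine ⟨fun f k hk => ?_, fun f k hk => ?_, fun s k hk => ?_⟩
  · cases k with
    | triv f' k => exact hk
    | graph g =>
      by_cases hex : ∃ Y, g.edge g.root f Y
      · obtain ⟨Y, hY⟩ := hex
        change PartOf σ t (GraphElem.app f (.graph g))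
        rw [GraphElem.app_graph _ hY]
        refine ⟨fun Y f Z h => hk.1 _ _ _ h.2, fun Z => ?_⟩
        by_cases hZ : Z ∈ (g.restrict Y (g.edge_mem _ _ _ hY).2).nodes
        · left
          have : Relation.ReflTransGen (fun a b => ∃ f, g.edge a f b) Y Z := hZ
          refine (if_pos this).trans ((hk.2 Z).resolve_right fun h => h ?_)
          exact g.reach_mem (g.edge_mem _ _ _ hY).2 this
        · exact .inr hZ
      · change PartOf σ t (GraphElem.app f (.graph g))
        rw [GraphElem.app, dif_neg hex]
        exact hk
  · cases k with
    | triv f' k => rfl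
    | graph g =>
      change extend A α (GraphElem.app f (.graph g)) = A.feat f (α g.root)
      by_cases hex : ∃ Y, g.edge g.root f Y
      · obtain ⟨Y, hY⟩ := hex
        rw [GraphElem.app_graph _ hY]
        exact denotAt_edge hp h (hk.1 _ _ _ hY)
      · rw [GraphElem.app, dif_neg hex]
        rfl
  -- Nodes labelled `⊤` impose no condition: by antisymmetry `⊤` lies below `s` to positive degree
  -- only if `s` is `⊤`.
  · have top : ∀ (e : A.Dom), min (σ.le σ.top s) p ≤ A.sort s e := by
      intro e
      rcases eq_or_ne (σ.le σ.top s) 0 with h0 | h0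
      · rw [h0]; exact (min_le_left _ _).trans unitInterval.nonneg'
      · rw [σ.eq_top_of_le_pos (unitInterval.pos_iff_ne_zero.2 h0), A.sort_top]
        exact unitInterval.le_one'
    cases k with
    | triv f' k => exact top _
    | graph g =>
      change min (σ.le (g.label g.root) s) p ≤ A.sort s (α g.root)
      rw [(hk.2 g.root).resolve_right (not_not_intro g.root_mem)]
      rcases t.sortOf_hasSort_or_top (σ := σ) g.root with h1 | h1
      · refine le_trans ?_ (A.sort_le (t.sortOf σ g.root) s _)
        rw [min_comm]
        exact min_le_min_right _ (denotAt_le_sort hp h h1)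
      · rw [h1]; exact top _

end OSFTerm

end TermGraph

/-! ### Subsumption -/

section Subsumption

variable {S : Type u} {F : Type v} {V : Type w} {σ : FuzzySignature S F}

/-- The supremum is attained: where `⟦t₁⟧(d)` exceeds `⟦t₂⟧(d)`, every admissible `β` is at most
`⟦t₂⟧(d)`, hence so is their supremum. -/
theorem subsumption_spec (σ : FuzzySignature S F) (t₁ t₂ : OSFTerm S F V)
    (A : Interp.{u, v, max u v w} σ) (d : A.Dom) :
    min (t₁.denot A d) (subsumption σ t₁ t₂) ≤ t₂.denot A d := by
  rcases le_or_gt (t₁.denot A d) (t₂.denot A d) with h | h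
  · exact (min_le_left _ _).trans h
  · refine (min_le_right _ _).trans (sSup_le fun _ hβ => ?_)
    rcases min_le_iff.1 (hβ A d) with h' | h'
    · exact absurd h h'.not_gt
    · exact h'

theorem le_subsumption {t₁ t₂ : OSFTerm S F V} {β : unitInterval}
    (h : ∀ (A : Interp.{u, v, max u v w} σ) (d : A.Dom), min (t₁.denot A d) β ≤ t₂.denot A d) :
    β ≤ subsumption σ t₁ t₂ :=
  le_sSup h

theorem subsumption_refl (t : OSFTerm S F V) : subsumption σ t t = 1 :=
  le_antisymm unitInterval.le_one' (le_subsumption fun _ _ => min_le_left _ _)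

theorem subsumption_trans (t₁ t₂ t₃ : OSFTerm S F V) :
    min (subsumption σ t₁ t₂) (subsumption σ t₂ t₃) ≤ subsumption σ t₁ t₃ := by
  refine le_subsumption fun A d => ?_
  rw [← min_assoc]
  exact (min_le_min_right _ (subsumption_spec σ t₁ t₂ A d)).trans (subsumption_spec σ t₂ t₃ A d)

/-- Genericity of the graph: each assignment satisfying `t` at `d` to degree `p > 0` induces a
`p`-homomorphism sending the graph of `t` to `d`, and this transports the degree of `t'` from the
graph to `d`. -/
theorem denotAt_toGraph_le_subsumption {t : OSFTerm S F V} (ht : t.Normal σ)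
    (t' : OSFTerm S F V) (α : V → GraphElem σ V) :
    t'.denotAt (graphAlgebra σ V) α (.graph (t.toGraph ht)) ≤ subsumption σ t t' := by
  refine le_subsumption fun A d => ?_
  rw [min_comm]
  rcases le_or_gt (t'.denotAt (graphAlgebra σ V) α (.graph (t.toGraph ht))) (t'.denot A d)
    with h | h
  · exact (min_le_left _ _).trans h
  -- Since the degree at the graph now exceeds `⟦t'⟧(d)`, it remains to bound `⟦t⟧` by `⟦t'⟧` at
  -- `d`, one assignment at a time.
  refine (min_le_right _ _).trans (iSup_le fun δ => ?_)
  rcases eq_or_ne (t.denotAt A δ d) 0 with h0 | h0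
  · rw [h0]; exact unitInterval.nonneg'
  have h0 := unitInterval.pos_iff_ne_zero.2 h0
  have h1 := (OSFTerm.isMorphismOn_extend h0 le_rfl).denotAt_le α t' (OSFTerm.PartOf.toGraph ht)
  have h2 : OSFTerm.extend A δ (.graph (t.toGraph ht)) = d := (OSFTerm.denotAt_eq_root h0).symm
  rw [h2] at h1
  have h3 := h1.trans (OSFTerm.denotAt_le_denot _ _ _)
  rcases min_le_iff.1 h3 with h4 | h4
  · exact absurd h h4.not_gt
  · exact h4

theorem subsumption_pos_iff {t : OSFTerm S F V} (ht : t.Normal σ) {t' : OSFTerm S F V} :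
    0 < subsumption σ t t' ↔ 0 < t'.denot (graphAlgebra σ V) (.graph (t.toGraph ht)) := by
  constructor
  · intro h
    refine lt_of_lt_of_le (lt_min ?_ h) (subsumption_spec σ t t' _ _)
    exact OSFTerm.denot_pos_iff.2 ⟨_, (OSFTerm.denotAt_toGraph ht).symm ▸ zero_lt_one⟩
  · intro h
    obtain ⟨α, h⟩ := OSFTerm.denot_pos_iff.1 h
    exact h.trans_le (denotAt_toGraph_le_subsumption ht t' α)

theorem subsumption_var_bot_left (X : V) (t : OSFTerm S F V) :
    subsumption σ (OSFTerm.var X σ.bot) t = 1 := by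
  refine le_antisymm unitInterval.le_one' (le_subsumption fun A d => ?_)
  rw [OSFTerm.denot_var_bot]
  exact (min_le_left _ _).trans unitInterval.nonneg'

theorem subsumption_var_bot_right {t : OSFTerm S F V} (ht : t.Normal σ) (X : V) :
    ¬ 0 < subsumption σ t (OSFTerm.var X σ.bot) := by
  rw [subsumption_pos_iff ht]
  exact fun h => (OSFTerm.denot_var_bot (graphAlgebra σ V) X _ ▸ h).ne rfl

/-- Directions reverse: a homomorphism out of the graph of `t'` transports its degree-1 satisfaction
of `t'` to the graph of `t`. -/
theorem subsumption_of_isMorphism {t t' : OSFTerm S F V} (ht : t.Normal σ) (ht' : t'.Normal σ)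
    {γ : (graphGen (t'.toGraph ht')).Dom → (graphGen (t.toGraph ht)).Dom}
    (hγ : Interp.IsMorphism _ _ 1 γ)
    (hr : γ (graphGenRoot (t'.toGraph ht')) = graphGenRoot (t.toGraph ht)) :
    subsumption σ t t' = 1 := by
  classical
  -- The values off the generated subalgebra are arbitrary.
  let γ' : (graphAlgebra σ V).Dom → (graphAlgebra σ V).Dom := fun h =>
    if hh : h ∈ (graphAlgebra σ V).featClosure {.graph (t'.toGraph ht')} then (γ ⟨h, hh⟩).1 else h
  have hm : Interp.IsMorphismOn (A := graphAlgebra σ V) (B := graphAlgebra σ V)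
      ((graphAlgebra σ V).featClosure {.graph (t'.toGraph ht')}) 1 γ' := by
    refine ⟨fun f d hd => Interp.feat_mem_featClosure hd f, fun f d hd => ?_, fun s d hd => ?_⟩
    · simp only [γ']
      rw [dif_pos hd, dif_pos (Interp.feat_mem_featClosure hd f)]
      exact congrArg Subtype.val (hγ.map_feat f ⟨d, hd⟩)
    · simp only [γ']
      rw [dif_pos hd]
      exact hγ.map_sort s ⟨d, hd⟩
  have hg : (.graph (t'.toGraph ht') : GraphElem σ V) ∈
      (graphAlgebra σ V).featClosure {.graph (t'.toGraph ht')} := ⟨[], _, rfl, rfl⟩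
  have h1 := hm.denotAt_le (t'.toGraph ht').assign t' hg
  have h2 : γ' (.graph (t'.toGraph ht')) = .graph (t.toGraph ht) :=
    (dif_pos hg).trans (congrArg Subtype.val hr)
  rw [h2, OSFTerm.denotAt_toGraph, min_self] at h1
  exact le_antisymm unitInterval.le_one' (h1.trans (denotAt_toGraph_le_subsumption ht t' _))

theorem subsumption_of_termEquiv {ψ₁ ψ₂ : PsiTerm σ V} (h : TermEquiv σ ψ₁ ψ₂) :
    subsumption σ ψ₁.1 ψ₂.1 = 1 := by
  rcases h with ⟨h₁, h₂, -, γ, hγ, hr⟩ | ⟨⟨X, hX⟩, -⟩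
  · exact subsumption_of_isMorphism h₁ h₂ hγ hr
  · rw [hX, subsumption_var_bot_left]

theorem subsumption_congr_le {ψ₁ ψ₁' ψ₂ ψ₂' : PsiTerm σ V} (h₁ : TermEquiv σ ψ₁ ψ₁')
    (h₂ : TermEquiv σ ψ₂ ψ₂') : subsumption σ ψ₁.1 ψ₂.1 ≤ subsumption σ ψ₁'.1 ψ₂'.1 := by
  have h1 := subsumption_trans (σ := σ) ψ₁'.1 ψ₁.1 ψ₂.1
  have h2 := subsumption_trans (σ := σ) ψ₁'.1 ψ₂.1 ψ₂'.1
  rw [subsumption_of_termEquiv ((termSetoid σ V).symm h₁), min_eq_right unitInterval.le_one'] at h1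
  rw [subsumption_of_termEquiv h₂, min_eq_left unitInterval.le_one'] at h2
  exact h1.trans h2

/-- A homomorphism between the generated subalgebras from positive subsumption. -/
theorem exists_isMorphism_of_denot_pos {t t' : OSFTerm S F V} (ht : t.Normal σ) (ht' : t'.Normal σ)
    (h : 0 < subsumption σ t t') (h' : 0 < subsumption σ t' t) :
    ∃ γ, Interp.IsMorphism (graphGen (t.toGraph ht)) (graphGen (t'.toGraph ht')) 1 γ ∧
      γ (graphGenRoot (t.toGraph ht)) = graphGenRoot (t'.toGraph ht') := by
  have key : ∀ {a b : OSFTerm S F V} (ha : a.Normal σ) (hb : b.Normal σ),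
      0 < subsumption σ b a → ∃ γ : GraphElem σ V → GraphElem σ V, ∃ D p, 0 < p ∧
        Interp.IsMorphismOn (A := graphAlgebra σ V) (B := graphAlgebra σ V) D p γ ∧
        .graph (a.toGraph ha) ∈ D ∧ γ (.graph (a.toGraph ha)) = .graph (b.toGraph hb) := by
    intro a b ha hb h
    obtain ⟨α, h⟩ := OSFTerm.denot_pos_iff.1 ((subsumption_pos_iff hb).1 h)
    exact ⟨_, _, _, h, OSFTerm.isMorphismOn_extend h le_rfl, OSFTerm.PartOf.toGraph ha,
      (OSFTerm.denotAt_eq_root h).symm⟩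
  -- The root label of an element holds there to degree 1, so its image carries that sort to
  -- positive degree. With both directions, the labels along each word coincide, which upgrades the
  -- degree of `γ` to 1.
  have lab : ∀ {a b : OSFTerm S F V} (ha : a.Normal σ) (hb : b.Normal σ),
      0 < subsumption σ b a → ∀ l,
        0 < σ.le ((graphAlgebra σ V).word l (.graph (b.toGraph hb))).rootLabel
          ((graphAlgebra σ V).word l (.graph (a.toGraph ha))).rootLabel := by
    intro a b ha hb h l
    obtain ⟨γ, D, p, hp, hγ, hD, hr⟩ := key ha hb h
    have h1 := hγ.map_word l hD
    have h2 := hγ.map_sort ((graphAlgebra σ V).word l (.graph (a.toGraph ha))).rootLabel _ h1.1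
    rw [h1.2, hr] at h2
    refine lt_of_lt_of_le (lt_min ?_ hp) h2
    change 0 < σ.le _ _
    rw [σ.le_self]; exact zero_lt_one
  obtain ⟨γ, D, p, hp, hγ, hD, hr⟩ := key ht ht' h'
  have hword : ∀ l, γ ((graphAlgebra σ V).word l (.graph (t.toGraph ht))) =
      (graphAlgebra σ V).word l (.graph (t'.toGraph ht')) := fun l => by
    rw [(hγ.map_word l hD).2, hr]
  have hmem : ∀ e ∈ (graphAlgebra σ V).featClosure {.graph (t.toGraph ht)}, e ∈ D ∧
      γ e ∈ (graphAlgebra σ V).featClosure {.graph (t'.toGraph ht')} := by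
    intro e he
    obtain ⟨l, rfl⟩ := Interp.mem_featClosure_singleton.1 he
    exact ⟨(hγ.map_word l hD).1, Interp.mem_featClosure_singleton.2 ⟨l, hword l⟩⟩
  refine ⟨fun e => ⟨γ e.1, (hmem e.1 e.2).2⟩, ⟨fun f e => Subtype.ext ?_, fun s e => ?_⟩,
    Subtype.ext hr⟩
  · exact hγ.map_feat f e.1 (hmem e.1 e.2).1
  · refine (min_le_left _ _).trans ?_
    obtain ⟨l, hl⟩ := Interp.mem_featClosure_singleton.1 e.2
    change σ.le (GraphElem.rootLabel e.1) s ≤ σ.le (GraphElem.rootLabel (γ e.1)) s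
    rw [hl, hword, σ.eq_of_le_pos (lab ht ht' h' l) (lab ht' ht h l)]

theorem termEquiv_of_subsumption_pos {ψ₁ ψ₂ : PsiTerm σ V} (h : 0 < subsumption σ ψ₁.1 ψ₂.1)
    (h' : 0 < subsumption σ ψ₂.1 ψ₁.1) : TermEquiv σ ψ₁ ψ₂ := by
  rcases ψ₁.2 with h₁ | ⟨X, h₁⟩ <;> rcases ψ₂.2 with h₂ | ⟨Y, h₂⟩
  · exact .inl ⟨h₁, h₂, exists_isMorphism_of_denot_pos h₁ h₂ h h',
      exists_isMorphism_of_denot_pos h₂ h₁ h' h⟩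
  · rw [h₂] at h; exact (subsumption_var_bot_right h₁ Y h).elim
  · rw [h₁] at h'; exact (subsumption_var_bot_right h₂ X h').elim
  · exact .inr ⟨⟨X, h₁⟩, ⟨Y, h₂⟩⟩

end Subsumption

/-! ### Paths of terms -/

section Paths

variable {S : Type u} {F : Type v} {V : Type w} {σ : FuzzySignature S F}

namespace OSFTerm

theorem denotAt_mk_pos {A : Interp.{u, v, x} σ} (α : V → A.Dom) (X : V) (s : S) (n : ℕ)
    (feat : Fin n → F) (sub : Fin n → OSFTerm S F V) (d : A.Dom) :
    0 < (mk X s n feat sub).denotAt A α d ↔ d = α X ∧ 0 < A.sort s d ∧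
      ∀ i, 0 < (sub i).denotAt A α (A.feat (feat i) d) := by
  constructor
  · intro h
    obtain ⟨h1, h2, h3⟩ := (denotAt_mk _ _ _ _ _ _ _ _ h).1 le_rfl
    exact ⟨h1, h.trans_le h2, fun i => h.trans_le (h3 i)⟩
  · rintro ⟨h1, h2, h3⟩
    obtain ⟨p, hp, hp'⟩ : ∃ p : unitInterval, 0 < p ∧
        ∀ i, p ≤ (sub i).denotAt A α (A.feat (feat i) d) := by
      rcases isEmpty_or_nonempty (Fin n) with h | h
      · exact ⟨1, zero_lt_one, fun i => h.elim i⟩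
      · obtain ⟨i, hi⟩ := Finite.exists_min fun i => (sub i).denotAt A α (A.feat (feat i) d)
        exact ⟨_, h3 i, hi⟩
    have h4 := lt_min h2 hp
    exact h4.trans_le ((denotAt_mk _ _ _ _ _ _ _ _ h4).2
      ⟨h1, min_le_left _ _, fun i => (min_le_right _ _).trans (hp' i)⟩)

/-- `t.OccursAt u Y s`: the word `u` of features leads in `t` from the root to a subterm
with root `Y` and root sort `s`. -/
def OccursAt : OSFTerm S F V → List F → V → S → Prop
  | mk X s _ feat sub, u, Y, s' =>
    (u = [] ∧ X = Y ∧ s = s') ∨ ∃ i v, u = feat i :: v ∧ (sub i).OccursAt v Y s'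

/-- Terms branch finitely, so positivity of the infimum is a conjunction of crisp conditions, one
for each occurrence and expressed by the word leading to it. -/
theorem denotAt_pos_iff {A : Interp.{u, v, x} σ} {α : V → A.Dom} {t : OSFTerm S F V}
    {d : A.Dom} :
    0 < t.denotAt A α d ↔
      ∀ u Y s, t.OccursAt u Y s → α Y = A.word u d ∧ 0 < A.sort s (A.word u d) := by
  induction t generalizing d with
  | mk X s n feat sub ih =>
    rw [denotAt_mk_pos]
    constructor
    · rintro ⟨h1, h2, h3⟩ u Y s' (⟨rfl, rfl, rfl⟩ | ⟨i, v, rfl, h⟩)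
      · exact ⟨h1.symm, h2⟩
      · exact (ih i).1 (h3 i) v Y s' h
    · intro h
      have h0 := h [] X s (.inl ⟨rfl, rfl, rfl⟩)
      exact ⟨h0.1.symm, h0.2, fun i => (ih i).2 fun u Y s' hu =>
        h (feat i :: u) Y s' (.inr ⟨i, u, rfl, hu⟩)⟩

/-- The words of features that lead somewhere in `t`. -/
def paths (t : OSFTerm S F V) : Set (List F) := {u | ∃ Y s, t.OccursAt u Y s}

theorem finite_paths (t : OSFTerm S F V) : t.paths.Finite := by
  induction t with
  | mk X s n feat sub ih =>
    refine ((Set.finite_singleton []).union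
      (Set.finite_iUnion fun i => (ih i).image (feat i :: ·))).subset ?_
    rintro u ⟨Y, s', ⟨rfl, -⟩ | ⟨i, v, rfl, h⟩⟩
    · exact .inl rfl
    · exact .inr (Set.mem_iUnion.2 ⟨i, v, ⟨Y, s', h⟩, rfl⟩)

theorem nil_mem_paths (t : OSFTerm S F V) : [] ∈ t.paths := by
  cases t with
  | mk X s n feat sub => exact ⟨X, s, .inl ⟨rfl, rfl, rfl⟩⟩

theorem mem_paths_of_prefix {t : OSFTerm S F V} {u v : List F} (hu : u ∈ t.paths)
    (h : v <+: u) : v ∈ t.paths := by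
  induction t generalizing u v with
  | mk X s n feat sub ih =>
    cases v with
    | nil => exact nil_mem_paths _
    | cons f v =>
      obtain ⟨Y, s', ⟨rfl, -⟩ | ⟨i, w, rfl, h'⟩⟩ := hu
      · simp at h
      · obtain ⟨rfl, hv⟩ := List.cons_prefix_cons.1 h
        obtain ⟨Y', s'', h''⟩ := ih i ⟨Y, s', h'⟩ hv
        exact ⟨Y', s'', .inr ⟨i, v, rfl, h''⟩⟩

end OSFTerm

end Paths

/-! ### Normal terms from right congruences on words -/

/-- A presentation of a rooted graph: the nodes are the classes of the words in `mem`, and `u`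
leads to `u ++ [f]` for `f` in the finite set `feats`, whenever `u ++ [f]` is in `mem`. -/
structure WordGraph {S : Type u} {F : Type v} (σ : FuzzySignature S F) (V : Type w) where
  rel : List F → List F → Prop
  rel_equiv : Equivalence rel
  rel_concat : ∀ u v f, rel u v → rel (u ++ [f]) (v ++ [f])
  mem : Set (List F)
  nil_mem : [] ∈ mem
  mem_congr : ∀ u v, rel u v → u ∈ mem → v ∈ mem
  feats : Finset F
  var : List F → V
  var_eq_iff : ∀ u ∈ mem, ∀ v ∈ mem, var u = var v ↔ rel u v
  finite_var : (var '' mem).Finite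
  label : List F → S
  label_congr : ∀ u v, rel u v → label u = label v
  label_ne_bot : ∀ u, label u ≠ σ.bot

namespace WordGraph

variable {S : Type u} {F : Type v} {V : Type w} {σ : FuzzySignature S F} (W : WordGraph σ V)

/-- The words that can be read from the root. -/
def Reach (u : List F) : Prop := (∀ v, v <+: u → v ∈ W.mem) ∧ ∀ f ∈ u, f ∈ W.feats

variable {W} in
theorem Reach.mem {u : List F} (h : W.Reach u) : u ∈ W.mem := h.1 u List.prefix_rfl

theorem reach_nil : W.Reach [] := by
  refine ⟨fun v hv => ?_, by simp⟩
  rw [List.prefix_nil.1 hv]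
  exact W.nil_mem

theorem reach_concat {u : List F} {f : F} :
    W.Reach (u ++ [f]) ↔ W.Reach u ∧ f ∈ W.feats ∧ u ++ [f] ∈ W.mem := by
  simp only [Reach, List.prefix_concat_iff, List.mem_append, List.mem_singleton]
  constructor
  · rintro ⟨h1, h2⟩
    exact ⟨⟨fun v hv => h1 v (.inr hv), fun g hg => h2 g (.inl hg)⟩, h2 f (.inr rfl),
      h1 _ (.inl rfl)⟩
  · rintro ⟨⟨h1, h2⟩, h3, h4⟩
    refine ⟨?_, ?_⟩
    · rintro v (rfl | hv)
      · exact h4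
      · exact h1 v hv
    · rintro g (hg | rfl)
      · exact h2 g hg
      · exact h3

theorem reach_concat_congr {u v : List F} {f : F} (h : W.rel u v) (hv : W.Reach v)
    (hu : W.Reach (u ++ [f])) : W.Reach (v ++ [f]) := by
  obtain ⟨-, h2, h3⟩ := W.reach_concat.1 hu
  exact W.reach_concat.2 ⟨hv, h2, W.mem_congr _ _ (W.rel_concat _ _ f h) h3⟩

/-- The order on words for which primary words are least in their class. -/
def wordLT (u v : List F) : Prop := List.Shortlex WellOrderingRel u.reverse v.reverse

/-- The least reachable words of their classes. -/
def Primary (u : List F) : Prop := W.Reach u ∧ ∀ v, W.Reach v → W.rel v u → ¬ wordLT v u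

theorem exists_primary {u : List F} (h : W.Reach u) : ∃ v, W.Primary v ∧ W.rel v u := by
  have wf : WellFounded (wordLT (F := F)) :=
    InvImage.wf List.reverse (List.Shortlex.wf IsWellFounded.wf)
  obtain ⟨v, ⟨hv, hvu⟩, hmin⟩ := wf.has_min {v | W.Reach v ∧ W.rel v u} ⟨u, h, W.rel_equiv.refl u⟩
  exact ⟨v, ⟨hv, fun v' h1 h2 => hmin v' ⟨h1, W.rel_equiv.trans h2 hvu⟩⟩, hvu⟩

variable {W} in
theorem Primary.eq_of_rel {u v : List F} (hu : W.Primary u) (hv : W.Primary v)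
    (h : W.rel u v) : u = v :=
  List.reverse_injective <| Std.Trichotomous.trichotomous (r := List.Shortlex WellOrderingRel) _ _
    (hv.2 u hu.1 h) (hu.2 v hv.1 (W.rel_equiv.symm h))

variable {W} in
-- Comparing reversed words makes the order stable under appending a last letter, so a smaller
-- representative of `u` would yield one of `u ++ [f]`. The primary words thus form a prefix-closed
-- set of representatives, a spanning tree of the graph.
theorem Primary.of_concat {u : List F} {f : F} (h : W.Primary (u ++ [f])) : W.Primary u := by
  refine ⟨(W.reach_concat.1 h.1).1, fun v hv hr hlt => ?_⟩
  refine h.2 (v ++ [f]) (W.reach_concat_congr (W.rel_equiv.symm hr) hv h.1)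
    (W.rel_concat _ _ f hr) ?_
  simp only [wordLT, List.reverse_append, List.reverse_cons, List.reverse_nil, List.nil_append,
    List.singleton_append]
  exact List.shortlex_cons_iff.2 hlt

theorem finite_primary : {u | W.Primary u}.Finite := by
  refine Set.Finite.of_finite_image (f := W.var) (W.finite_var.subset ?_) ?_
  · rintro _ ⟨u, hu, rfl⟩
    exact ⟨u, Reach.mem hu.1, rfl⟩
  · intro u hu v hv h
    exact Primary.eq_of_rel hu hv ((W.var_eq_iff _ (Reach.mem hu.1) _ (Reach.mem hv.1)).1 h)

/-- With this depth the unfolding from the root expands every primary word. The inequality is strict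
because an unfolding of depth 0 expands nothing. -/
theorem exists_length_bound : ∃ K, ∀ u, W.Primary u → u.length < K := by
  obtain ⟨K, hK⟩ := (W.finite_primary.image List.length).bddAbove
  exact ⟨K + 1, fun u hu => Nat.lt_succ_of_le (hK ⟨u, hu, rfl⟩)⟩

open Classical in
/-- The features that can be read at `u`. -/
noncomputable def succ (u : List F) : Finset F := W.feats.filter fun f => u ++ [f] ∈ W.mem

theorem mem_succ {u : List F} {f : F} : f ∈ W.succ u ↔ f ∈ W.feats ∧ u ++ [f] ∈ W.mem := by
  classical exact Finset.mem_filter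

/-- The features that can be read at `u`, enumerated. -/
noncomputable def succFeat (u : List F) (i : Fin (W.succ u).card) : F :=
  ((W.succ u).equivFin.symm i).1

theorem succFeat_injective (u : List F) : Function.Injective (W.succFeat u) :=
  Subtype.val_injective.comp (W.succ u).equivFin.symm.injective

variable {W} in
theorem Reach.concat_succFeat {u : List F} (h : W.Reach u) (i : Fin (W.succ u).card) :
    W.Reach (u ++ [W.succFeat u i]) := by
  exact W.reach_concat.2 ⟨h, W.mem_succ.1 ((W.succ u).equivFin.symm i).2⟩

theorem exists_succFeat {u : List F} {f : F} (h : W.Reach (u ++ [f])) :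
    ∃ i, W.succFeat u i = f := by
  have hf : f ∈ W.succ u := W.mem_succ.2 (W.reach_concat.1 h).2
  exact ⟨(W.succ u).equivFin ⟨f, hf⟩, by simp [succFeat]⟩

open Classical in
/-- The unfolding at `u` of the presented graph up to the depth `k`: only primary words are
expanded. -/
noncomputable def toTerm : ℕ → List F → OSFTerm S F V
  | 0, u => OSFTerm.var (W.var u) σ.top
  | k + 1, u =>
    if W.Primary u then
      OSFTerm.mk (W.var u) (W.label u) (W.succ u).card (W.succFeat u)
        fun i => toTerm k (u ++ [W.succFeat u i])
    else OSFTerm.var (W.var u) σ.top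

theorem toTerm_primary (k : ℕ) {u : List F} (h : W.Primary u) :
    W.toTerm (k + 1) u = OSFTerm.mk (W.var u) (W.label u) (W.succ u).card (W.succFeat u)
        fun i => W.toTerm k (u ++ [W.succFeat u i]) := if_pos h

theorem toTerm_of_not_primary (k : ℕ) {u : List F} (h : ¬ W.Primary u) :
    W.toTerm k u = OSFTerm.var (W.var u) σ.top := by
  cases k with
  | zero => rfl
  | succ k => exact if_neg h

/-- Case distinction on the shape of an unfolding. -/
theorem toTerm_cases (k : ℕ) (u : List F) :
    W.toTerm k u = OSFTerm.var (W.var u) σ.top ∨ ∃ k', k = k' + 1 ∧ W.Primary u := by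
  cases k with
  | zero => exact .inl rfl
  | succ k =>
    by_cases h : W.Primary u
    · exact .inr ⟨k, rfl, h⟩
    · exact .inl (W.toTerm_of_not_primary _ h)

theorem root_toTerm (k : ℕ) (u : List F) : (W.toTerm k u).root = W.var u := by
  rcases W.toTerm_cases k u with h | ⟨k, rfl, h⟩
  · rw [h]; rfl
  · rw [W.toTerm_primary k h]; rfl

theorem tags_toTerm (k : ℕ) {u : List F} (hu : W.Reach u) {Y : V} (hY : Y ∈ (W.toTerm k u).tags) :
    ∃ v, W.Reach v ∧ W.var v = Y := by
  induction k generalizing u with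
  | zero =>
    have : Y = W.var u := by simpa [toTerm, OSFTerm.var, OSFTerm.tags] using hY
    exact ⟨u, hu, this.symm⟩
  | succ k ih =>
    rcases W.toTerm_cases (k + 1) u with h | ⟨k', hk, h⟩
    · rw [h] at hY
      have : Y = W.var u := by simpa [OSFTerm.var, OSFTerm.tags] using hY
      exact ⟨u, hu, this.symm⟩
    · rw [W.toTerm_primary k h] at hY
      simp only [OSFTerm.tags, Set.mem_union, Set.mem_singleton_iff, Set.mem_iUnion] at hY
      rcases hY with rfl | ⟨i, hi⟩
      · exact ⟨u, hu, rfl⟩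
      · exact ih (hu.concat_succFeat i) hi

theorem nontrivialCount_var_top (X Y : V) :
    (OSFTerm.var X σ.top : OSFTerm S F V).nontrivialCount σ Y = 0 := by
  simp [OSFTerm.var, OSFTerm.nontrivialCount]

open Classical in
-- Only primary words are expanded and each class has one, so the only possible nontrivial
-- occurrence of `W.var v` is at `v` itself, below `u` only if `u` is a prefix of `v`.
theorem nontrivialCount_toTerm (k : ℕ) {u v : List F} (hu : W.Reach u) (hv : W.Primary v) :
    (W.toTerm k u).nontrivialCount σ (W.var v) ≤ if u <+: v then 1 else 0 := by
  induction k generalizing u with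
  | zero => rw [toTerm, nontrivialCount_var_top]; exact Nat.zero_le _
  | succ k ih =>
    rcases W.toTerm_cases (k + 1) u with h | ⟨k', hk, h⟩
    · rw [h, nontrivialCount_var_top]; exact Nat.zero_le _
    rw [W.toTerm_primary k h, OSFTerm.nontrivialCount]
    have hi : ∀ i, (W.toTerm k (u ++ [W.succFeat u i])).nontrivialCount σ (W.var v) ≤
        if u ++ [W.succFeat u i] <+: v then 1 else 0 := fun i => ih (hu.concat_succFeat i)
    have hsum := Finset.sum_le_sum fun i (_ : i ∈ Finset.univ) => hi i
    by_cases huv : u = v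
    · subst huv
      have : ∀ i, ¬ (u ++ [W.succFeat u i] <+: u) := fun i hp => by
        have := hp.length_le
        simp at this
      simp only [this, if_false, Finset.sum_const_zero] at hsum
      rw [if_pos List.prefix_rfl]
      split_ifs <;> omega
    · have hne : ¬ (W.var u = W.var v ∧ ¬ (W.label u = σ.top ∧ (W.succ u).card = 0)) :=
        fun hc => huv (h.eq_of_rel hv ((W.var_eq_iff _ hu.mem _ hv.1.mem).1 hc.1))
      rw [if_neg hne, zero_add]
      refine hsum.trans ?_
      by_cases hp : u <+: v
      · rw [if_pos hp]
        obtain ⟨l, rfl⟩ := hp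
        -- At most one branch continues towards `v`: its feature must be the next letter of `v`.
        rw [Finset.sum_boole, Nat.cast_id, Finset.card_le_one]
        intro i hi j hj
        simp only [Finset.mem_filter, Finset.mem_univ, true_and, List.prefix_append_right_inj] at hi hj
        apply W.succFeat_injective u
        cases l with
        | nil => simp at hi
        | cons f l =>
          simp only [List.cons_prefix_cons, List.nil_prefix, and_true] at hi hj
          rw [hi, hj]
      · rw [if_neg hp]
        refine (Finset.sum_eq_zero fun i _ => if_neg fun h' => hp ?_).le
        exact (List.prefix_append _ _).trans h'

theorem normal_var_top (htop : σ.top ≠ σ.bot) (X : V) :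
    (OSFTerm.var X σ.top : OSFTerm S F V).Normal σ :=
  ⟨htop, fun i => i.elim0, fun i => i.elim0, fun Y _ => by
    change (OSFTerm.var X σ.top : OSFTerm S F V).nontrivialCount σ Y ≤ 1
    rw [nontrivialCount_var_top]; exact Nat.zero_le _⟩

theorem normal_toTerm (k : ℕ) {u : List F} (hu : W.Reach u) : (W.toTerm k u).Normal σ := by
  have htop : σ.top ≠ σ.bot := σ.top_ne_bot_of_ne (W.label_ne_bot [])
  induction k generalizing u with
  | zero => exact normal_var_top htop _
  | succ k ih =>
    rcases W.toTerm_cases (k + 1) u with h | ⟨k', hk, h⟩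
    · rw [h]; exact normal_var_top htop _
    rw [W.toTerm_primary k h]
    refine ⟨W.label_ne_bot u, W.succFeat_injective u, fun i => ih (hu.concat_succFeat i),
      fun Y hY => ?_⟩
    rw [← W.toTerm_primary k h] at hY ⊢
    obtain ⟨v, hv, rfl⟩ := W.tags_toTerm _ hu hY
    obtain ⟨v', hv', hr⟩ := W.exists_primary hv
    rw [← (W.var_eq_iff _ hv'.1.mem _ hv.mem).2 hr]
    refine (W.nontrivialCount_toTerm _ hu hv').trans ?_
    split_ifs <;> omega

theorem denotAt_toTerm_pos {A : Interp.{u, v, x} σ} {α : V → A.Dom} {d : A.Dom}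
    (hα : ∀ u, W.Reach u → α (W.var u) = A.word u d)
    (hs : ∀ u, W.Reach u → 0 < A.sort (W.label u) (A.word u d)) (k : ℕ) {u : List F}
    (hu : W.Reach u) : 0 < (W.toTerm k u).denotAt A α (A.word u d) := by
  have hvar : 0 < (OSFTerm.var (W.var u) σ.top : OSFTerm S F V).denotAt A α (A.word u d) := by
    refine (OSFTerm.denotAt_mk_pos _ _ _ _ _ _ _).2 ⟨(hα u hu).symm, ?_, fun i => i.elim0⟩
    rw [A.sort_top]; exact zero_lt_one
  induction k generalizing u with
  | zero => exact hvar
  | succ k ih =>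
    rcases W.toTerm_cases (k + 1) u with h | ⟨k', hk, h⟩
    · rw [h]; exact hvar
    rw [W.toTerm_primary k h]
    refine (OSFTerm.denotAt_mk_pos _ _ _ _ _ _ _).2 ⟨(hα u hu).symm, hs u hu, fun i => ?_⟩
    rw [← A.word_concat]
    have hu' := hu.concat_succFeat i
    refine ih hu' ((OSFTerm.denotAt_mk_pos _ _ _ _ _ _ _).2
      ⟨(hα _ hu').symm, ?_, fun i => i.elim0⟩)
    rw [A.sort_top]; exact zero_lt_one

/-- The unfolding loses no information: `prim` descends the spanning tree, `expand` reads off the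
label and all outgoing edges at primary words, and `key` follows an arbitrary reachable word,
replacing it at each letter by the primary word of its class. -/
theorem of_denotAt_toTerm_pos {A : Interp.{u, v, x} σ} {α : V → A.Dom} {d : A.Dom} {K : ℕ}
    (hK : ∀ u, W.Primary u → u.length < K) (h : 0 < (W.toTerm K []).denotAt A α d) {u : List F}
    (hu : W.Reach u) :
    α (W.var u) = A.word u d ∧ 0 < A.sort (W.label u) (A.word u d) := by
  have prim : ∀ u, W.Primary u → 0 < (W.toTerm (K - u.length) u).denotAt A α (A.word u d) := by
    intro u
    induction u using List.reverseRecOn with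
    | nil => exact fun _ => h
    | append_singleton u f ih =>
      intro hp
      have hu := hp.of_concat
      have h1 := ih hu
      have hlt := hK _ hp
      rw [List.length_append, List.length_singleton] at hlt ⊢
      obtain ⟨i, rfl⟩ := W.exists_succFeat hp.1
      rw [show K - u.length = (K - (u.length + 1)) + 1 by omega, W.toTerm_primary _ hu,
        OSFTerm.denotAt_mk_pos] at h1
      rw [A.word_concat]
      exact h1.2.2 i
  have expand : ∀ v, W.Primary v → α (W.var v) = A.word v d ∧
      0 < A.sort (W.label v) (A.word v d) ∧
      ∀ f, W.Reach (v ++ [f]) → α (W.var (v ++ [f])) = A.word (v ++ [f]) d := by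
    intro v hv
    have h1 := prim v hv
    have hlt := hK v hv
    rw [show K - v.length = (K - (v.length + 1)) + 1 by omega, W.toTerm_primary _ hv,
      OSFTerm.denotAt_mk_pos] at h1
    refine ⟨h1.1.symm, h1.2.1, fun f hf => ?_⟩
    obtain ⟨i, rfl⟩ := W.exists_succFeat hf
    have := OSFTerm.denotAt_eq_root (h1.2.2 i)
    rw [root_toTerm] at this
    rw [A.word_concat, this]
  have key : ∀ u, W.Reach u → α (W.var u) = A.word u d := by
    intro u
    induction u using List.reverseRecOn with
    | nil =>
      intro _
      have := OSFTerm.denotAt_eq_root h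
      rw [root_toTerm] at this
      exact this.symm
    | append_singleton u f ih =>
      intro huf
      have hu := (W.reach_concat.1 huf).1
      obtain ⟨v, hv, hr⟩ := W.exists_primary hu
      have hvf := W.reach_concat_congr (W.rel_equiv.symm hr) hv.1 huf
      rw [← (W.var_eq_iff _ hvf.mem _ huf.mem).2 (W.rel_concat _ _ f hr),
        (expand v hv).2.2 f hvf, A.word_concat, A.word_concat, ← (expand v hv).1,
        (W.var_eq_iff _ hv.1.mem _ hu.mem).2 hr, ih hu]
  refine ⟨key u hu, ?_⟩
  obtain ⟨v, hv, hr⟩ := W.exists_primary hu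
  rw [← W.label_congr _ _ hr, ← key u hu, ← (W.var_eq_iff _ hv.1.mem _ hu.mem).2 hr,
    (expand v hv).1]
  exact (expand v hv).2.1

end WordGraph

/-! ### Greatest lower bounds -/

section GreatestLowerBound

variable {S : Type u} {F : Type v} {V : Type w} {σ : FuzzySignature S F}

/-- A set of sorts that contains the top sort and is closed under greatest lower bounds has a
least element. -/
theorem FuzzySignature.exists_least (σ : FuzzySignature S F) (T : Set S) (htop : σ.top ∈ T)
    (hglb : ∀ s ∈ T, ∀ s' ∈ T, ∀ g, IsFuzzyGLB σ.le {s, s'} g → g ∈ T) :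
    ∃ s ∈ T, ∀ s' ∈ T, 0 < σ.le s s' := by
  have := σ.finite_sorts
  -- The bound is kept in `T` rather than in the growing subset, since the GLBs taken need only lie
  -- in `T`.
  refine Set.Finite.induction_on_subset (motive := fun T' _ => ∃ s ∈ T, ∀ s' ∈ T', 0 < σ.le s s') T
    (Set.toFinite T) ⟨σ.top, htop, by simp⟩ ?_
  rintro a T' ha - - ⟨s, hs, hs'⟩
  obtain ⟨g, hg, -⟩ := σ.isFuzzyLattice.exists_glb s a
  refine ⟨g, hglb s hs a ha g hg, ?_⟩
  rintro s' (rfl | h)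
  · exact hg.1 _ (by simp)
  · exact (lt_min (hg.1 s (by simp)) (hs' s' h)).trans_le (σ.isFuzzyLattice.trans _ _ _)

/-- Two terms with a common model have a normal term as their meet. -/
theorem exists_normal_meet [Infinite V] (t₁ t₂ : OSFTerm S F V) {A₀ : Interp.{u, v, y} σ}
    {d₀ : A₀.Dom} (h₁ : 0 < t₁.denot A₀ d₀) (h₂ : 0 < t₂.denot A₀ d₀) :
    ∃ t : OSFTerm S F V, t.Normal σ ∧ ∀ (A : Interp.{u, v, y} σ) (d : A.Dom),
      0 < t.denot A d ↔ 0 < t₁.denot A d ∧ 0 < t₂.denot A d := by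
  classical
  -- The meet is defined semantically, without unification: `r` and `T` collect the equations
  -- between words and the sort constraints that are valid in all common models.
  let M : (A : Interp.{u, v, y} σ) → A.Dom → Prop := fun A d => 0 < t₁.denot A d ∧ 0 < t₂.denot A d
  let r : Setoid (List F) :=
    { r := fun u v => ∀ A d, M A d → A.word u d = A.word v d
      iseqv := ⟨fun u A d _ => rfl, fun h A d hM => (h A d hM).symm,
        fun h h' A d hM => (h A d hM).trans (h' A d hM)⟩ }
  let T : List F → Set S := fun u => {s | ∀ A d, M A d → 0 < A.sort s (A.word u d)}
  have hleast : ∀ u, ∃ s ∈ T u, ∀ s' ∈ T u, 0 < σ.le s s' := fun u =>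
    σ.exists_least (T u) (fun A d _ => by rw [A.sort_top]; exact zero_lt_one)
      fun s hs s' hs' g hg A d hM => A.sort_glb s s' g _ hg (lt_min (hs A d hM) (hs' A d hM))
  choose label hlabel hlabel' using hleast
  -- There may be infinitely many classes of words and infinitely many features; the paths of the
  -- two terms give a finite part that still determines both.
  let P : Set (List F) := t₁.paths ∪ t₂.paths
  have hP : P.Finite := t₁.finite_paths.union t₂.finite_paths
  have hPr : ∀ u ∈ P, ∀ v, v <+: u → v ∈ P := by
    rintro u (hu | hu) v hv
    · exact .inl (OSFTerm.mem_paths_of_prefix hu hv)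
    · exact .inr (OSFTerm.mem_paths_of_prefix hu hv)
  have hfeats : (⋃ u ∈ P, {f | f ∈ u}).Finite := hP.biUnion fun u _ => u.finite_toSet
  have hN : (Quotient.mk r '' P).Finite := hP.image _
  -- Distinct classes need distinct variables; here the infinitude of `V` enters.
  obtain ⟨e⟩ : Nonempty ((Quotient.mk r '' P) ↪ V) := by
    have := hN.to_subtype
    have := Fintype.ofFinite (Quotient.mk r '' P)
    exact ⟨(Fintype.equivFin _).toEmbedding.trans
      (Fin.valEmbedding.trans (Infinite.natEmbedding V))⟩
  let name : Quotient r → V := fun q =>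
    if h : q ∈ Quotient.mk r '' P then e ⟨q, h⟩ else (Infinite.natEmbedding V) 0
  have hname : Set.InjOn name (Quotient.mk r '' P) := by
    intro q hq q' hq' h
    simp only [name, dif_pos hq, dif_pos hq'] at h
    exact congrArg Subtype.val (e.injective h)
  let W : WordGraph σ V :=
    { rel := r.r
      rel_equiv := r.iseqv
      rel_concat := fun u v f h A d hM => by rw [A.word_concat, A.word_concat, h A d hM]
      mem := {u | Quotient.mk r u ∈ Quotient.mk r '' P}
      nil_mem := ⟨[], .inl t₁.nil_mem_paths, rfl⟩
      mem_congr := fun u v h hu => by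
        have h' : Quotient.mk r u = Quotient.mk r v := Quotient.sound h
        rwa [Set.mem_ofPred_eq, ← h']
      feats := hfeats.toFinset
      var := fun u => name (Quotient.mk r u)
      var_eq_iff := fun u hu v hv =>
        ⟨fun h => Quotient.exact (hname hu hv h), fun h => congrArg name (Quotient.sound h)⟩
      finite_var := by
        refine (hN.image name).subset ?_
        rintro _ ⟨u, hu, rfl⟩
        exact ⟨_, hu, rfl⟩
      label := label
      label_congr := fun u v h => by
        have hT : T u = T v := Set.ext fun s =>
          forall_congr' fun A => forall_congr' fun d => forall_congr' fun hM => by rw [h A d hM]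
        exact σ.eq_of_le_pos (hlabel' u _ (hT ▸ hlabel v)) (hlabel' v _ (hT ▸ hlabel u))
      -- The given common model excludes `⊥`, which has degree 0 everywhere.
      label_ne_bot := fun u h => by
        have := hlabel u A₀ d₀ ⟨h₁, h₂⟩
        rw [h, A₀.sort_bot] at this
        exact lt_irrefl _ this }
  have hreach : ∀ u ∈ P, W.Reach u := fun u hu =>
    ⟨fun v hv => ⟨v, hPr u hu v hv, rfl⟩,
      fun f hf => hfeats.mem_toFinset.2 (Set.mem_biUnion hu hf)⟩
  obtain ⟨K, hK⟩ := W.exists_length_bound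
  refine ⟨W.toTerm K [], W.normal_toTerm K W.reach_nil, fun A d => ⟨fun h => ?_, fun hM => ?_⟩⟩
  · obtain ⟨α, hα⟩ := OSFTerm.denot_pos_iff.1 h
    have key : ∀ t : OSFTerm S F V, t.paths ⊆ P →
        (∀ (A : Interp.{u, v, y} σ) (d : A.Dom), M A d → 0 < t.denot A d) → 0 < t.denot A d := by
      intro t ht hMt
      refine OSFTerm.denot_pos_iff.2 ⟨fun Y =>
        if h : ∃ u s, t.OccursAt u Y s then A.word h.choose d else d, ?_⟩
      -- A tag `Y` is sent to the value of any word at which it occurs. The choice is harmless: two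
      -- such words agree in every common model, hence are `r`-related, get the same variable in the
      -- unfolding, and so agree at `d`.
      refine OSFTerm.denotAt_pos_iff.2 fun u Y s hu => ?_
      have huP : u ∈ P := ht ⟨Y, s, hu⟩
      have hu' := W.of_denotAt_toTerm_pos hK hα (hreach u huP)
      constructor
      · have hex : ∃ u s, t.OccursAt u Y s := ⟨u, s, hu⟩
        rw [dif_pos hex]
        obtain ⟨s', hs'⟩ := hex.choose_spec
        have hvP : hex.choose ∈ P := ht ⟨Y, s', hs'⟩
        have hv' := W.of_denotAt_toTerm_pos hK hα (hreach _ hvP)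
        rw [← hv'.1, ← hu'.1]
        refine congrArg (fun q => α (name q)) (Quotient.sound ?_)
        intro B e hM
        obtain ⟨β, hβ⟩ := OSFTerm.denot_pos_iff.1 (hMt B e hM)
        rw [← (OSFTerm.denotAt_pos_iff.1 hβ _ _ _ hs').1,
          ← (OSFTerm.denotAt_pos_iff.1 hβ _ _ _ hu).1]
      · refine (lt_min hu'.2 (hlabel' u s ?_)).trans_le (A.sort_le _ _ _)
        intro B e hM
        obtain ⟨β, hβ⟩ := OSFTerm.denot_pos_iff.1 (hMt B e hM)
        exact (OSFTerm.denotAt_pos_iff.1 hβ _ _ _ hu).2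
    exact ⟨key t₁ Set.subset_union_left fun _ _ hM => hM.1,
      key t₂ Set.subset_union_right fun _ _ hM => hM.2⟩
  · refine OSFTerm.denot_pos_iff.2 ⟨fun Y =>
      if h : ∃ u, W.Reach u ∧ W.var u = Y then A.word h.choose d else d, ?_⟩
    -- Every equation and label used in the unfolding is valid in all common models, in particular
    -- at `d`.
    refine W.denotAt_toTerm_pos (d := d) (fun u hu => ?_) (fun u hu => hlabel u A d hM) K W.reach_nil
    have hex : ∃ v, W.Reach v ∧ W.var v = W.var u := ⟨u, hu, rfl⟩
    rw [dif_pos hex]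
    exact (W.var_eq_iff _ hex.choose_spec.1.mem _ hu.mem).1 hex.choose_spec.2 A d hM

/-- Every two terms have a greatest lower bound with respect to positive subsumption. -/
theorem exists_psiTerm_glb [Infinite V] (ψ₁ ψ₂ : PsiTerm σ V) :
    ∃ ψ : PsiTerm σ V, 0 < subsumption σ ψ.1 ψ₁.1 ∧ 0 < subsumption σ ψ.1 ψ₂.1 ∧
      ∀ χ : PsiTerm σ V, 0 < subsumption σ χ.1 ψ₁.1 → 0 < subsumption σ χ.1 ψ₂.1 →
        0 < subsumption σ χ.1 ψ.1 := by
  -- The graph of a common normal lower bound provides the common model needed to form the meet;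
  -- without one, only inconsistent terms lie below both.
  by_cases hc : ∃ t : OSFTerm S F V, t.Normal σ ∧ 0 < subsumption σ t ψ₁.1 ∧
      0 < subsumption σ t ψ₂.1
  · obtain ⟨c, hc, h1, h2⟩ := hc
    obtain ⟨t, ht, hM⟩ := exists_normal_meet ψ₁.1 ψ₂.1 ((subsumption_pos_iff hc).1 h1)
      ((subsumption_pos_iff hc).1 h2)
    have key : ∀ {c : OSFTerm S F V}, c.Normal σ →
        (0 < subsumption σ c t ↔ 0 < subsumption σ c ψ₁.1 ∧ 0 < subsumption σ c ψ₂.1) := by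
      intro c hc
      rw [subsumption_pos_iff hc, subsumption_pos_iff hc, subsumption_pos_iff hc]
      exact hM _ _
    have hself : 0 < subsumption σ t t := by rw [subsumption_refl]; exact zero_lt_one
    refine ⟨⟨t, .inl ht⟩, ((key ht).1 hself).1, ((key ht).1 hself).2, fun χ h h' => ?_⟩
    rcases χ.2 with hχ | ⟨X, hX⟩
    · exact (key hχ).2 ⟨h, h'⟩
    · rw [hX, subsumption_var_bot_left]; exact zero_lt_one
  · obtain ⟨X⟩ : Nonempty V := inferInstance
    refine ⟨⟨OSFTerm.var X σ.bot, .inr ⟨X, rfl⟩⟩, ?_, ?_, fun χ h h' => ?_⟩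
    · rw [subsumption_var_bot_left]; exact zero_lt_one
    · rw [subsumption_var_bot_left]; exact zero_lt_one
    · rcases χ.2 with hχ | ⟨Y, hY⟩
      · exact (hc ⟨χ.1, hχ, h, h'⟩).elim
      · rw [hY, subsumption_var_bot_left]; exact zero_lt_one

end GreatestLowerBound

end FuzzyOSF

/-! ### The fuzzy lattice of equivalence classes -/

theorem mainTheorem8 {S : Type u} {F : Type v} {V : Type w} [Countable V] [Infinite V]
    (σ : FuzzyOSF.FuzzySignature S F) :
    ∃ R : FuzzyOSF.FuzzyRel (Quotient (FuzzyOSF.termSetoid σ V)),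
      (∀ ψ₁ ψ₂ : FuzzyOSF.PsiTerm σ V,
        R (Quotient.mk _ ψ₁) (Quotient.mk _ ψ₂) = FuzzyOSF.subsumption σ ψ₁.1 ψ₂.1) ∧
      FuzzyOSF.IsFuzzyLattice R := by
  refine ⟨Quotient.lift₂ (fun ψ₁ ψ₂ => FuzzyOSF.subsumption σ ψ₁.1 ψ₂.1)
    fun ψ₁ ψ₂ ψ₁' ψ₂' h₁ h₂ => le_antisymm (FuzzyOSF.subsumption_congr_le h₁ h₂)
      (FuzzyOSF.subsumption_congr_le ((FuzzyOSF.termSetoid σ V).symm h₁)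
        ((FuzzyOSF.termSetoid σ V).symm h₂)),
    fun _ _ => rfl, ?_⟩
  have po : FuzzyOSF.IsFuzzyPartialOrder (Quotient.lift₂
      (fun ψ₁ ψ₂ : FuzzyOSF.PsiTerm σ V => FuzzyOSF.subsumption σ ψ₁.1 ψ₂.1)
      fun ψ₁ ψ₂ ψ₁' ψ₂' h₁ h₂ => le_antisymm (FuzzyOSF.subsumption_congr_le h₁ h₂)
        (FuzzyOSF.subsumption_congr_le ((FuzzyOSF.termSetoid σ V).symm h₁)
        ((FuzzyOSF.termSetoid σ V).symm h₂)) :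
      FuzzyOSF.FuzzyRel (Quotient (FuzzyOSF.termSetoid σ V))) := by
    refine ⟨?_, ?_, ?_⟩
    · rintro ⟨ψ⟩
      exact FuzzyOSF.subsumption_refl _
    · rintro ⟨ψ₁⟩ ⟨ψ₂⟩ ⟨ψ₃⟩
      exact FuzzyOSF.subsumption_trans _ _ _
    · rintro ⟨ψ₁⟩ ⟨ψ₂⟩ h h'
      exact Quotient.sound (FuzzyOSF.termEquiv_of_subsumption_pos h h')
  refine { po with exists_glb := ?_ }
  rintro ⟨ψ₁⟩ ⟨ψ₂⟩
  obtain ⟨ψ, h1, h2, h3⟩ := FuzzyOSF.exists_psiTerm_glb ψ₁ ψ₂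
  refine ⟨Quotient.mk _ ψ, ⟨?_, ?_⟩, ?_⟩
  · rintro _ (rfl | rfl)
    · exact h1
    · exact h2
  · rintro ⟨χ⟩ hχ
    exact h3 χ (hχ _ (.inl rfl)) (hχ _ (.inr rfl))
  · intro q hq
    refine po.antisymm _ _ ?_ (hq.2 _ ?_)
    · obtain ⟨χ⟩ := q
      exact h3 χ (hq.1 _ (.inl rfl)) (hq.1 _ (.inr rfl))
    · rintro _ (rfl | rfl)
      · exact h1
      · exact h2
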